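/- Let $n\ge 3$, let $\Omega\subset\mathbb{R}^n$ be a smooth bounded domain, let $2^*=\frac{2n}{n-2}$ and let $\lambda\ge 0$. Let $H^1_0(\Omega)$ be the closure of $C_c^\infty(\Omega)$ for the norm $\|\nabla v\|_2$, and let $\|\cdot\|_{2^*}$ be the norm of $L^{2^*}(\Omega)$. All equations below are understood in the weak sense, tested against all $v\in H^1_0(\Omega)$. For a weight $w\in L^{2^*}(\Omega)\setminus\{0\}$ with $w\ge 0$ a.e., let $K_w$ be the space of measurable functions $v:\Omega\to\mathbb{R}$ with $w^{\frac{2}{n-2}}v=0$ a.e., and let $L^2_w(\Omega)=L^2(\Omega,w^{2^*-2}dx)/K_w$. For a linear subspace $V\subset H^1_0(\Omega)$ and $k\ge 1$, write $\dim_w V=k$ if $V=\mathrm{Span}(v_1,\dots,v_k)$ for some $v_1,\dots,v_k\in H^1_0(\Omega)$ that are linearly independent in $L^2_w(\Omega)$. For $k\ge1$ define the generalised eigenvalue $$\mu_k^\lambda(w)=\inf_{\dim_w V=k}\ \max_{v\in V\setminus\{0\}}\frac{\int_\Omega\left(|\nabla v|^2-\lambda v^2\right)dx}{\int_\Omega w^{2^*-2}v^2\,dx}\in[-\infty,+\infty),$$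 the infimum being over linear subspaces $V\subset H^1_0(\Omega)$, and, when $\mu_k^\lambda(w)$ is finite, let the generalised eigenspace $E_k^\lambda(w)$ be the set of all $\varphi\in H^1_0(\Omega)$ with $-\Delta\varphi-\lambda\varphi=\mu_k^\lambda(w)\,w^{2^*-2}\varphi$ in $\Omega$. Let $u\in H^1_0(\Omega)\setminus\{0\}$ and $\tilde u=u/\|u\|_{2^*}$. Then $u$ is a solution of the Brézis–Nirenberg problem $$-\Delta u-\lambda u=|u|^{2^*-2}u\ \text{ in }\Omega,\qquad u=0\ \text{ on }\partial\Omega,$$ if and only if there exists $k\ge1$ such that $\mu_k^\lambda(|\tilde u|)=\|u\|_{2^*}^{2^*-2}$ and $\tilde u\in E_k^\lambda(|\tilde u|)$. -/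

import Mathlib

open MeasureTheory TopologicalSpace
open scoped ContDiff Distributions Gradient ENNReal

noncomputable section

namespace BrezisNirenberg

/-- A smooth bounded domain of `ℝⁿ`: a nonempty connected bounded open set whose boundary is locally
the zero set of a smooth function with non-vanishing derivative, the set lying locally on one side
of its boundary. -/
structure IsSmoothBoundedDomain {n : ℕ} (Ω : Opens (EuclideanSpace ℝ (Fin n))) : Prop where
  isConnected : IsConnected (Ω : Set (EuclideanSpace ℝ (Fin n)))
  isBounded : Bornology.IsBounded (Ω : Set (EuclideanSpace ℝ (Fin n)))
  smooth_boundary : ∀ x ∈ frontier (Ω : Set (EuclideanSpace ℝ (Fin n))),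
    ∃ U : Set (EuclideanSpace ℝ (Fin n)), IsOpen U ∧ x ∈ U ∧
      ∃ ρ : EuclideanSpace ℝ (Fin n) → ℝ, ContDiffOn ℝ ∞ ρ U ∧ fderiv ℝ ρ x ≠ 0 ∧
        ∀ y ∈ U, (y ∈ Ω ↔ ρ y < 0)

variable {n : ℕ}

/-- The critical Sobolev exponent `2* = 2n/(n-2)`. -/
def critExp (n : ℕ) : ℝ := 2 * (n : ℝ) / ((n : ℝ) - 2)

/-- Lebesgue measure on `Ω`. -/
abbrev vol (Ω : Opens (EuclideanSpace ℝ (Fin n))) : Measure (EuclideanSpace ℝ (Fin n)) :=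
  volume.restrict (Ω : Set (EuclideanSpace ℝ (Fin n)))

/-- The Hilbert space `L²(Ω) × L²(Ω; ℝⁿ)`. -/
abbrev L2Pair (Ω : Opens (EuclideanSpace ℝ (Fin n))) : Type :=
  WithLp 2 (Lp ℝ 2 (vol Ω) × Lp (EuclideanSpace ℝ (Fin n)) 2 (vol Ω))

/-- The pairs `(φ, ∇φ)` with `φ ∈ C_c^∞(Ω)`, as a subspace of `L²(Ω) × L²(Ω; ℝⁿ)`. -/
def testPairs (Ω : Opens (EuclideanSpace ℝ (Fin n))) : Submodule ℝ (L2Pair Ω) where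
  carrier := {p | ∃ φ : 𝓓(Ω, ℝ), p.fst =ᵐ[vol Ω] φ ∧ p.snd =ᵐ[vol Ω] ∇ (φ : _ → ℝ)}
  zero_mem' := by
    refine ⟨0, Lp.coeFn_zero _ _ _, ?_⟩
    filter_upwards [Lp.coeFn_zero (EuclideanSpace ℝ (Fin n)) 2 (vol Ω)] with x hx
    have h0 : ((0 : 𝓓(Ω, ℝ)) : EuclideanSpace ℝ (Fin n) → ℝ) = fun _ => 0 := rfl
    rw [h0]
    simpa [gradient] using hx
  add_mem' := by
    rintro p q ⟨φ, hp, hp'⟩ ⟨ψ, hq, hq'⟩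
    refine ⟨φ + ψ, ?_, ?_⟩
    · filter_upwards [Lp.coeFn_add p.fst q.fst, hp, hq] with x h h1 h2
      change (p.fst + q.fst : Lp ℝ 2 (vol Ω)) x = φ x + ψ x
      rw [h, Pi.add_apply, h1, h2]
    · filter_upwards [Lp.coeFn_add p.snd q.snd, hp', hq'] with x h h1 h2
      have dφ := (φ.contDiff.differentiable (by simp)) x
      have dψ := (ψ.contDiff.differentiable (by simp)) x
      change (p.snd + q.snd : Lp (EuclideanSpace ℝ (Fin n)) 2 (vol Ω)) x =
        ∇ ((φ : EuclideanSpace ℝ (Fin n) → ℝ) + (ψ : EuclideanSpace ℝ (Fin n) → ℝ)) x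
      rw [h, Pi.add_apply, h1, h2]
      simp [gradient, fderiv_add dφ dψ]
  smul_mem' := by
    rintro c p ⟨φ, hp, hp'⟩
    refine ⟨c • φ, ?_, ?_⟩
    · filter_upwards [Lp.coeFn_smul c p.fst, hp] with x h h1
      change (c • p.fst : Lp ℝ 2 (vol Ω)) x = c • φ x
      rw [h, Pi.smul_apply, h1]
    · filter_upwards [Lp.coeFn_smul c p.snd, hp'] with x h h1
      have dφ := (φ.contDiff.differentiable (by simp)) x
      change (c • p.snd : Lp (EuclideanSpace ℝ (Fin n)) 2 (vol Ω)) x =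
        ∇ (c • (φ : EuclideanSpace ℝ (Fin n) → ℝ)) x
      rw [h, Pi.smul_apply, h1]
      simp [gradient, fderiv_const_smul dφ c]

/-- `H¹₀(Ω)`: the closure of `C_c^∞(Ω)` in the `H¹` norm `(‖v‖₂² + ‖∇v‖₂²)^{1/2}`, which on bounded
`Ω` is equivalent to `‖∇v‖₂`. A function `v` is recorded together with its weak gradient. -/
abbrev H10 (Ω : Opens (EuclideanSpace ℝ (Fin n))) : Submodule ℝ (L2Pair Ω) :=
  (testPairs Ω).topologicalClosure

variable {Ω : Opens (EuclideanSpace ℝ (Fin n))}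

/-- The function underlying an element of `H¹₀(Ω)`. -/
def fn (v : H10 Ω) : Lp ℝ 2 (vol Ω) := (v : L2Pair Ω).fst

/-- The weak gradient of an element of `H¹₀(Ω)`. -/
def grad (v : H10 Ω) : Lp (EuclideanSpace ℝ (Fin n)) 2 (vol Ω) := (v : L2Pair Ω).snd

/-- The norm `‖u‖_{2*}` of `L^{2*}(Ω)`. -/
def critNorm (u : H10 Ω) : ℝ := lpNorm (fn u) (ENNReal.ofReal (critExp n)) (vol Ω)

/-- `φ ∈ H¹₀(Ω)` is a weak solution of `-Δφ - lam φ = f` in `Ω`. -/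
def IsWeakSol (lam : ℝ) (φ : H10 Ω) (f : EuclideanSpace ℝ (Fin n) → ℝ) : Prop :=
  ∀ v : H10 Ω, (∫ x, inner ℝ (grad φ x) (grad v x) ∂(vol Ω)) -
      lam * (∫ x, fn φ x * fn v x ∂(vol Ω)) =
    ∫ x, f x * fn v x ∂(vol Ω)

/-- `u` solves the Brézis–Nirenberg problem `-Δu - lam u = |u|^{2*-2} u` in `Ω`, `u = 0` on `∂Ω`. -/
def SolvesBN (lam : ℝ) (u : H10 Ω) : Prop :=
  IsWeakSol lam u (fun x => |fn u x| ^ (critExp n - 2) * fn u x)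

/-- The space `K_w` of measurable functions `v` (up to equality a.e.) with `w^{2/(n-2)} v = 0` a.e.
in `Ω`. -/
def weightNull (Ω : Opens (EuclideanSpace ℝ (Fin n))) (w : EuclideanSpace ℝ (Fin n) → ℝ) :
    Submodule ℝ (EuclideanSpace ℝ (Fin n) →ₘ[vol Ω] ℝ) where
  carrier := {v | ∀ᵐ x ∂(vol Ω), w x ^ (2 / ((n : ℝ) - 2)) * v x = 0}
  zero_mem' := by
    filter_upwards [AEEqFun.coeFn_zero (α := EuclideanSpace ℝ (Fin n)) (μ := vol Ω) (β := ℝ)]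
      with x hx
    simp [hx]
  add_mem' := by
    intro v v' hv hv'
    change ∀ᵐ x ∂(vol Ω), w x ^ (2 / ((n : ℝ) - 2)) * (v + v') x = 0
    filter_upwards [AEEqFun.coeFn_add v v', hv, hv'] with x h h1 h2
    rw [h, Pi.add_apply, mul_add, h1, h2, add_zero]
  smul_mem' := by
    intro c v hv
    change ∀ᵐ x ∂(vol Ω), w x ^ (2 / ((n : ℝ) - 2)) * (c • v) x = 0
    filter_upwards [AEEqFun.coeFn_smul c v, hv] with x h h1
    rw [h, Pi.smul_apply, smul_eq_mul, mul_left_comm, h1, mul_zero]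

/-- `dim_w V = k`: `V` is spanned by `k` elements of `H¹₀(Ω)` whose classes modulo `K_w`
(that is, in the weighted space `L²(Ω, w^{2*-2} dx) / K_w`) are linearly independent. -/
def HasWeightedDim (w : EuclideanSpace ℝ (Fin n) → ℝ) (V : Submodule ℝ (H10 Ω)) (k : ℕ) : Prop :=
  ∃ v : Fin k → H10 Ω, V = Submodule.span ℝ (Set.range v) ∧
    LinearIndependent ℝ
      (fun i => (weightNull Ω w).mkQ (fn (v i) : EuclideanSpace ℝ (Fin n) →ₘ[vol Ω] ℝ))

/-- The generalised Rayleigh quotient `∫ (|∇v|² - lam v²) / ∫ w^{2*-2} v²`. -/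
def rayleigh (lam : ℝ) (w : EuclideanSpace ℝ (Fin n) → ℝ) (v : H10 Ω) : ℝ :=
  (∫ x, (‖grad v x‖ ^ 2 - lam * fn v x ^ 2) ∂(vol Ω)) /
    ∫ x, w x ^ (critExp n - 2) * fn v x ^ 2 ∂(vol Ω)

/-- The generalised eigenvalue `μ_k^lam(w) ∈ [-∞, ∞]`, the infimum over all subspaces `V` of
`H¹₀(Ω)` with `dim_w V = k` of the maximum over `V \ {0}` of the Rayleigh quotient. -/
def genEigenvalue (Ω : Opens (EuclideanSpace ℝ (Fin n))) (lam : ℝ)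
    (w : EuclideanSpace ℝ (Fin n) → ℝ) (k : ℕ) : EReal :=
  ⨅ (V : Submodule ℝ (H10 Ω)) (_ : HasWeightedDim w V k), ⨆ v ∈ {v : H10 Ω | v ∈ V ∧ v ≠ 0},
    (rayleigh lam w v : EReal)

/-- The generalised eigenspace `E_k^lam(w)`: the `φ ∈ H¹₀(Ω)` that solve weakly
`-Δφ - lam φ = μ_k^lam(w) w^{2*-2} φ` in `Ω`; it is meaningful (and nonempty) only if
`μ_k^lam(w)` is finite. -/
def genEigenspace (Ω : Opens (EuclideanSpace ℝ (Fin n))) (lam : ℝ)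
    (w : EuclideanSpace ℝ (Fin n) → ℝ) (k : ℕ) : Set (H10 Ω) :=
  {φ | ∃ μ : ℝ, genEigenvalue Ω lam w k = (μ : EReal) ∧
    IsWeakSol lam φ (fun x => μ * w x ^ (critExp n - 2) * fn φ x)}

end BrezisNirenberg

end

/-! Put `c = ‖u‖_{2*}` and `μ = c^{2*-2}`. Dividing by `c` turns the nonlinear equation for `u` into
the linear weighted equation `-Δũ - lam ũ = μ |ũ|^{2*-2} ũ` (`solvesBN_iff_isWeakSol`). This settles
one direction; for the other it remains to see that `μ` is one of the min-max values `μ_k`.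

Write `A(v) = ∫ |∇v|² - lam v²`, `g = |ũ|^{2/(n-2)}` and `D(v) = ∫ g² v²`. The form `A - μ D` has
finite Morse index `m` (`exists_morse_bound`), and `k = m + 1` works (`exists_minmax_index`). No
family of `m + 1` vectors makes `A - μ D` negative, hence `μ_k ≥ μ`. Conversely `ũ` lies in the
kernel of `A - μ D`; adjoined to a maximal negative family it makes `A - s D` negative for every `s
> μ`, hence `μ_k ≤ s`. The weight may vanish on a large set, where `A` can be negative while `D =
0`, so this family may be dependent modulo `K_w`. A small perturbation repairs this: multiplication
by `g` has infinite rank, and negativity on a finite-dimensional space is an open condition.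

Finiteness of the index needs no spectral theory. As `g ∈ Lⁿ`, Hölder and Sobolev give `D(v) ≤ C
‖v‖₂² + ε ‖∇v‖₂²` (`exists_norm_weightLM_sq_le`), and prescribing zero mean on the cubes of a fine
grid makes `‖v‖₂²` small against `‖∇v‖₂²` (`exists_functionals_norm_le`). -/

noncomputable section

namespace BrezisNirenberg

/-! ### Abstract min-max principle for a pair of quadratic forms. -/

section MinMax

variable {H Z : Type*} [NormedAddCommGroup H] [NormedSpace ℝ H] [AddCommGroup Z] [Module ℝ Z]

/-- Given a linear map `T` of infinite rank and a finite family `w`, there is a family `e` such that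
all the families `w + t e`, `t ≠ 0`, are linearly independent after applying `T`. -/
theorem exists_perturbation_linearIndependent (T : H →ₗ[ℝ] Z) (hT : ¬ (LinearMap.range T).FG)
    {k : ℕ} (w : Fin k → H) :
    ∃ e : Fin k → H, ∀ t : ℝ, t ≠ 0 → LinearIndependent ℝ (fun i => T (w i + t • e i)) := by
  classical
  -- The `e i` are chosen with images independent modulo `S`. Modulo `S` the image of `w i + t e i`
  -- is then `t` times that of `e i`, so independence holds for every `t ≠ 0`.
  set S : Submodule ℝ Z := Submodule.span ℝ (Set.range fun i => T (w i))
  have hS : S.FG := Submodule.fg_span (Set.finite_range _)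
  have hR : ¬ (LinearMap.range (S.mkQ ∘ₗ T)).FG := by
    intro h
    apply hT
    apply Submodule.fg_of_fg_map_of_fg_inf_ker S.mkQ
    · rwa [← LinearMap.range_comp]
    · rw [Submodule.ker_mkQ]
      have : FiniteDimensional ℝ S := Module.Finite.iff_fg.2 hS
      exact Module.Finite.iff_fg.1 (Submodule.finiteDimensional_of_le inf_le_right)
  have hrank : (k : Cardinal) ≤ Module.rank ℝ (LinearMap.range (S.mkQ ∘ₗ T)) := by
    by_contra! hlt
    apply hR
    rw [← Module.Finite.iff_fg]
    exact Module.rank_lt_aleph0_iff.1 (hlt.trans Cardinal.natCast_lt_aleph0)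
  obtain ⟨f, hf⟩ := exists_linearIndependent_of_le_rank hrank
  have hf' : LinearIndependent ℝ (fun i => (f i : Z ⧸ S)) :=
    hf.map' (Submodule.subtype _) (Submodule.ker_subtype _)
  choose e he using fun i => (f i).2
  refine ⟨e, fun t ht => ?_⟩
  have key : LinearIndependent ℝ (fun i => S.mkQ (T (w i + t • e i))) := by
    have : (fun i => S.mkQ (T (w i + t • e i))) = fun i => t • (f i : Z ⧸ S) := by
      funext i
      have h0 : S.mkQ (T (w i)) = 0 := by
        rw [Submodule.mkQ_apply, Submodule.Quotient.mk_eq_zero]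
        exact Submodule.subset_span ⟨i, rfl⟩
      rw [map_add, map_add, h0, map_smul, map_smul, zero_add]
      exact congrArg _ (he i)
    rw [this]
    exact hf'.units_smul (fun _ => Units.mk0 t ht)
  exact LinearIndependent.of_comp S.mkQ key

/-- A continuous homogeneous function that is negative on all nontrivial combinations of a finite
family stays so under small perturbations of the family. -/
theorem eventually_neg_of_neg {q : H → ℝ} (hq : Continuous q)
    (hom : ∀ (c : ℝ) v, q (c • v) = c ^ 2 * q v) {k : ℕ} (w e : Fin k → H)
    (hw : ∀ a : Fin k → ℝ, a ≠ 0 → q (∑ i, a i • w i) < 0) :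
    ∀ᶠ t : ℝ in nhds 0, ∀ a : Fin k → ℝ, a ≠ 0 → q (∑ i, a i • (w i + t • e i)) < 0 := by
  have hc : Continuous (fun z : ℝ × (Fin k → ℝ) => q (∑ i, z.2 i • (w i + z.1 • e i))) := by
    fun_prop
  -- By homogeneity the unit sphere of coefficients suffices, and its compactness makes the range of
  -- `t` uniform in `a`.
  have h1 : ∀ᶠ t : ℝ in nhds 0, ∀ a ∈ Metric.sphere (0 : Fin k → ℝ) 1,
      q (∑ i, a i • (w i + t • e i)) < 0 := by
    apply (isCompact_sphere (0 : Fin k → ℝ) 1).eventually_forall_of_forall_eventually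
      (P := fun t a => q (∑ i, a i • (w i + t • e i)) < 0)
    intro a ha
    apply hc.continuousAt.eventually_lt continuousAt_const
    have ha0 : a ≠ 0 := by
      rintro rfl
      simp at ha
    simpa using hw a ha0
  filter_upwards [h1] with t ht a ha
  have hna : ‖a‖ ≠ 0 := norm_ne_zero_iff.2 ha
  have h2 := ht (‖a‖⁻¹ • a) (by simp [norm_smul, hna])
  have h3 : ∑ i, a i • (w i + t • e i) = ‖a‖ • ∑ i, (‖a‖⁻¹ • a) i • (w i + t • e i) := by
    rw [Finset.smul_sum]
    refine Finset.sum_congr rfl fun i _ => ?_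
    rw [Pi.smul_apply, smul_smul, smul_eq_mul, mul_inv_cancel_left₀ hna]
  rw [h3, hom]
  exact mul_neg_of_pos_of_neg (by positivity) h2

/-- Abstract min-max principle: if `A - μ D` has finite Morse index, `D` is nonnegative, and `u` with
`D u u > 0` lies in the kernel of `A - μ D`, then `μ` is one of the min-max values of `A` relative
to `D`; the trial families may be chosen independent modulo the kernel of any linear map `T` of
infinite rank. -/
theorem exists_minmax_index (T : H →ₗ[ℝ] Z) (hT : ¬ (LinearMap.range T).FG)
    (A D : LinearMap.BilinForm ℝ H) (hAs : ∀ v w, A v w = A w v) (hDs : ∀ v w, D v w = D w v)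
    (hA : Continuous fun v => A v v) (hD : Continuous fun v => D v v)
    (hD0 : ∀ v, 0 ≤ D v v)
    {μ : ℝ} {M : ℕ} (hM : ∀ v : Fin (M + 1) → H, ∃ a : Fin (M + 1) → ℝ, a ≠ 0 ∧
      0 ≤ A (∑ i, a i • v i) (∑ i, a i • v i) - μ * D (∑ i, a i • v i) (∑ i, a i • v i))
    {u : H} (hu : 0 < D u u) (hker : ∀ v, A u v = μ * D u v) :
    ∃ k : ℕ, 1 ≤ k ∧
      (∀ v : Fin k → H, ∃ a : Fin k → ℝ, a ≠ 0 ∧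
        μ * D (∑ i, a i • v i) (∑ i, a i • v i) ≤ A (∑ i, a i • v i) (∑ i, a i • v i)) ∧
      ∀ s > μ, ∃ v : Fin k → H, LinearIndependent ℝ (fun i => T (v i)) ∧
        ∀ a : Fin k → ℝ, a ≠ 0 →
          A (∑ i, a i • v i) (∑ i, a i • v i) < s * D (∑ i, a i • v i) (∑ i, a i • v i) := by
  -- Strict negativity forces such a family to be independent, since a vanishing nontrivial
  -- combination would give `0 < 0`.
  set P : ℕ → Prop := fun m => ∃ v : Fin m → H, ∀ a : Fin m → ℝ, a ≠ 0 →
    A (∑ i, a i • v i) (∑ i, a i • v i) - μ * D (∑ i, a i • v i) (∑ i, a i • v i) < 0 with hPdef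
  have hP0 : P 0 := ⟨Fin.elim0, fun a ha => absurd (Subsingleton.elim a 0) ha⟩
  obtain ⟨m, ⟨w, hw⟩, hm⟩ : ∃ m, P m ∧ ¬ P (m + 1) := by
    by_contra! hcon
    have hall : ∀ m, P m := fun m => Nat.rec hP0 (fun m hm => hcon m hm) m
    obtain ⟨v, hv⟩ := hall (M + 1)
    obtain ⟨a, ha, h⟩ := hM v
    exact absurd (hv a ha) (not_lt.2 h)
  -- The extra dimension is the one contributed by `u`; it also ensures `1 ≤ k`.
  refine ⟨m + 1, by omega, ?_, ?_⟩
  · intro v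
    by_contra! hcon
    exact hm ⟨v, fun a ha => by linarith [hcon a ha]⟩
  · intro s hs
    set q : H → ℝ := fun v => A v v - s * D v v with hq
    have hqc : Continuous q := hA.sub (continuous_const.mul hD)
    have hom : ∀ (c : ℝ) v, q (c • v) = c ^ 2 * q v := by
      intro c v
      simp only [hq, map_smul, LinearMap.smul_apply, smul_eq_mul]
      ring
    have hneg : ∀ a : Fin (m + 1) → ℝ, a ≠ 0 →
        q (∑ i, a i • (Fin.snoc w u : Fin (m + 1) → H) i) < 0 := by
      intro a ha
      rw [Fin.sum_univ_castSucc]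
      simp only [Fin.snoc_castSucc, Fin.snoc_last]
      set x : H := ∑ i : Fin m, a i.castSucc • w i with hx
      set c := a (Fin.last m)
      -- The square term in `u` and the cross term vanish because `u` is in the kernel of `A - μ D`.
      -- Strictness then comes from `x` if its coefficients are not all zero, and otherwise from `D
      -- u u > 0`.
      have e1 : q (x + c • u) = (A x x - μ * D x x) + c ^ 2 * (A u u - μ * D u u)
          + 2 * c * (A u x - μ * D u x) - (s - μ) * D (x + c • u) (x + c • u) := by
        simp only [hq, map_add, map_smul, LinearMap.add_apply, LinearMap.smul_apply, smul_eq_mul]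
        rw [hAs x u, hDs x u]
        ring
      rw [e1, hker u, hker x]
      by_cases hb : (fun i : Fin m => a i.castSucc) = 0
      · have hx0 : x = 0 := by
          rw [hx]
          exact Finset.sum_eq_zero fun i _ => by rw [show a i.castSucc = 0 from congrFun hb i]; simp
        have hc : c ≠ 0 := by
          intro hc
          apply ha
          funext i
          refine Fin.lastCases hc (fun j => congrFun hb j) i
        rw [hx0]
        simp only [map_zero, zero_add, map_smul, LinearMap.smul_apply, smul_eq_mul]
        have : 0 < (s - μ) * (c * (c * D u u)) := by
          have : 0 < c * c := mul_self_pos.2 hc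
          rw [← mul_assoc c]
          exact mul_pos (sub_pos.2 hs) (mul_pos this hu)
        simpa using this
      · have h1 := hw _ hb
        have h2 : 0 ≤ (s - μ) * D (x + c • u) (x + c • u) := mul_nonneg (sub_pos.2 hs).le (hD0 _)
        linarith
    -- The family `(w, u)` may itself be dependent after `T`, so a small `t ≠ 0` is taken from the
    -- punctured neighbourhood.
    obtain ⟨e, he⟩ := exists_perturbation_linearIndependent T hT (Fin.snoc w u : Fin (m + 1) → H)
    have hev := eventually_neg_of_neg hqc hom _ e hneg
    have hev' : ∀ᶠ t : ℝ in nhdsWithin 0 {0}ᶜ, t ≠ 0 := self_mem_nhdsWithin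
    obtain ⟨t, ht, ht0⟩ := ((hev.filter_mono nhdsWithin_le_nhds).and hev').exists
    exact ⟨_, he t ht0, fun a ha => by linarith [ht a ha]⟩

end MinMax

/-! ### The space `H¹₀(Ω)`: Sobolev inequality and uniqueness of the weak gradient. -/

section Basic

variable {n : ℕ} {Ω : Opens (EuclideanSpace ℝ (Fin n))}

/-- The continuous linear map sending an element of `H¹₀(Ω)` to its underlying function. -/
def fnL (Ω : Opens (EuclideanSpace ℝ (Fin n))) : H10 Ω →L[ℝ] Lp ℝ 2 (vol Ω) :=
  (WithLp.fstL 2 ℝ _ _).comp (H10 Ω).subtypeL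

/-- The continuous linear map sending an element of `H¹₀(Ω)` to its weak gradient. -/
def gradL (Ω : Opens (EuclideanSpace ℝ (Fin n))) :
    H10 Ω →L[ℝ] Lp (EuclideanSpace ℝ (Fin n)) 2 (vol Ω) :=
  (WithLp.sndL 2 ℝ _ _).comp (H10 Ω).subtypeL

theorem fnL_apply (v : H10 Ω) : fnL Ω v = fn v := rfl

theorem gradL_apply (v : H10 Ω) : gradL Ω v = grad v := rfl

theorem eq_zero_of_fn_grad {v : H10 Ω} (h1 : fn v = 0) (h2 : grad v = 0) : v = 0 := by
  apply Subtype.ext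
  apply WithLp.ofLp_injective 2
  exact Prod.ext h1 h2

/-- A closed property that holds for test functions holds on `H¹₀(Ω)`. -/
theorem H10_induction {p : H10 Ω → Prop} (hc : IsClosed {v | p v})
    (h : ∀ (φ : 𝓓(Ω, ℝ)) (v : H10 Ω), fn v =ᵐ[vol Ω] φ →
      grad v =ᵐ[vol Ω] ∇ (φ : _ → ℝ) → p v) (v : H10 Ω) : p v := by
  have hd : DenseRange (Set.inclusion (subset_closure (s := (testPairs Ω : Set (L2Pair Ω))))) :=
    (denseRange_inclusion_iff _).2 subset_rfl
  refine hd.induction_on (p := fun w : closure (testPairs Ω : Set (L2Pair Ω)) => p ⟨w.1, w.2⟩)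
    ⟨v.1, v.2⟩ hc ?_
  rintro ⟨w, φ, h1, h2⟩
  exact h φ _ h1 h2

theorem norm_gradient (φ : EuclideanSpace ℝ (Fin n) → ℝ) (x : EuclideanSpace ℝ (Fin n)) :
    ‖∇ φ x‖ = ‖fderiv ℝ φ x‖ := LinearIsometryEquiv.norm_map _ _

theorem support_subset (φ : 𝓓(Ω, ℝ)) : Function.support φ ⊆ Ω :=
  (subset_tsupport _).trans φ.tsupport_subset

theorem support_fderiv_subset (φ : 𝓓(Ω, ℝ)) : Function.support (fderiv ℝ φ) ⊆ Ω :=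
  (_root_.support_fderiv_subset ℝ).trans φ.tsupport_subset

theorem continuous_fderiv_test (φ : 𝓓(Ω, ℝ)) : Continuous (fderiv ℝ φ) :=
  φ.contDiff.continuous_fderiv (by simp)

theorem continuous_gradient (φ : 𝓓(Ω, ℝ)) : Continuous (∇ (φ : _ → ℝ)) :=
  (LinearIsometryEquiv.continuous _).comp (continuous_fderiv_test φ)

theorem hasCompactSupport_gradient (φ : 𝓓(Ω, ℝ)) : HasCompactSupport (∇ (φ : _ → ℝ)) :=
  (φ.hasCompactSupport.fderiv ℝ).comp_left (map_zero _)

theorem enorm_gradL_eq {v : H10 Ω} {φ : 𝓓(Ω, ℝ)} (h : grad v =ᵐ[vol Ω] ∇ (φ : _ → ℝ)) :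
    ENNReal.ofReal ‖gradL Ω v‖ = eLpNorm (fderiv ℝ φ) 2 volume := by
  have hs : Function.support (∇ (φ : _ → ℝ)) ⊆ Ω := fun x hx =>
    support_fderiv_subset φ fun h0 => hx <| by rw [gradient, h0, map_zero]
  rw [Lp.norm_def, ENNReal.ofReal_toReal (Lp.eLpNorm_ne_top _), gradL_apply, eLpNorm_congr_ae h,
    eLpNorm_restrict_eq_of_support_subset hs]
  exact eLpNorm_congr_norm_ae (.of_forall fun x => norm_gradient _ x)

theorem critExp_pos (hn : 3 ≤ n) : 0 < critExp n := by
  have : (3 : ℝ) ≤ n := by exact_mod_cast hn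
  unfold critExp
  apply div_pos <;> linarith

/-- The Sobolev inequality on `H¹₀(Ω)`. -/
theorem exists_sobolev_const (hn : 3 ≤ n) (Ω : Opens (EuclideanSpace ℝ (Fin n))) :
    ∃ C : NNReal, ∀ v : H10 Ω, eLpNorm (fn v) (ENNReal.ofReal (critExp n)) (vol Ω) ≤
      C * ENNReal.ofReal ‖gradL Ω v‖ := by
  have hn' : (3 : ℝ) ≤ n := by exact_mod_cast hn
  refine ⟨eLpNormLESNormFDerivOfEqInnerConst
    (volume : Measure (EuclideanSpace ℝ (Fin n))) 2, fun v => ?_⟩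
  refine H10_induction (p := fun v => eLpNorm (fn v) (ENNReal.ofReal (critExp n)) (vol Ω) ≤
      (eLpNormLESNormFDerivOfEqInnerConst
        (volume : Measure (EuclideanSpace ℝ (Fin n))) 2 : NNReal) *
        ENNReal.ofReal ‖gradL Ω v‖) ?_ ?_ v
  -- The `L^{2*}` norm is not yet known to be finite or continuous on `H¹₀(Ω)`. Fatou along an a.e.
  -- convergent subsequence gives the lower semicontinuity that is enough.
  · apply IsSeqClosed.isClosed
    intro vs v hvs hlim
    have h1 : Filter.Tendsto (fun j => fnL Ω (vs j)) Filter.atTop (nhds (fnL Ω v)) :=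
      ((fnL Ω).continuous.tendsto v).comp hlim
    obtain ⟨ns, hns, hae⟩ := (tendstoInMeasure_of_tendsto_Lp h1).exists_seq_tendsto_ae
    have h2 := Lp.eLpNorm_lim_le_liminf_eLpNorm (p := ENNReal.ofReal (critExp n))
      (fun j => Lp.aestronglyMeasurable (fnL Ω (vs (ns j)))) _ hae
    refine h2.trans ?_
    have h3 : Filter.Tendsto (fun j => (eLpNormLESNormFDerivOfEqInnerConst
        (volume : Measure (EuclideanSpace ℝ (Fin n))) 2 : ℝ≥0∞) *
          ENNReal.ofReal ‖gradL Ω (vs (ns j))‖) Filter.atTop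
        (nhds ((eLpNormLESNormFDerivOfEqInnerConst
        (volume : Measure (EuclideanSpace ℝ (Fin n))) 2 : ℝ≥0∞) *
          ENNReal.ofReal ‖gradL Ω v‖)) := by
      apply ENNReal.Tendsto.const_mul _ (Or.inr ENNReal.coe_ne_top)
      apply ENNReal.tendsto_ofReal
      exact (((gradL Ω).continuous.norm.tendsto v).comp hlim).comp hns.tendsto_atTop
    rw [← h3.liminf_eq]
    exact Filter.liminf_le_liminf (.of_forall fun j => hvs (ns j))
  · intro φ v h1 h2
    rw [enorm_gradL_eq h2, eLpNorm_congr_ae h1,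
      eLpNorm_restrict_eq_of_support_subset (support_subset φ)]
    have hp : ((critExp n).toNNReal : ℝ) = critExp n := Real.coe_toNNReal _ (critExp_pos hn).le
    refine eLpNorm_le_eLpNorm_fderiv_of_eq_inner (p := 2) (p' := (critExp n).toNNReal) volume
      (φ.contDiff.of_le (by simp)) φ.hasCompactSupport (by norm_num) ?_ ?_
    · rw [finrank_euclideanSpace_fin]; omega
    · rw [hp, finrank_euclideanSpace_fin, critExp]
      have : (n : ℝ) - 2 ≠ 0 := by linarith
      have : (n : ℝ) ≠ 0 := by linarith
      push_cast
      field_simp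

theorem memLp_critExp (hn : 3 ≤ n) (v : H10 Ω) :
    MemLp (fn v) (ENNReal.ofReal (critExp n)) (vol Ω) := by
  obtain ⟨C, hC⟩ := exists_sobolev_const hn Ω
  exact ⟨Lp.aestronglyMeasurable _,
    (hC v).trans_lt (ENNReal.mul_lt_top ENNReal.coe_lt_top ENNReal.ofReal_lt_top)⟩

theorem memLp_smul_const (ψ : 𝓓(Ω, ℝ)) (e : EuclideanSpace ℝ (Fin n)) :
    MemLp (fun x => ψ x • e) 2 (vol Ω) :=
  (ψ.continuous.smul continuous_const).memLp_of_hasCompactSupport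
    (ψ.hasCompactSupport.smul_right)

theorem memLp_fderiv_apply (ψ : 𝓓(Ω, ℝ)) (e : EuclideanSpace ℝ (Fin n)) :
    MemLp (fun x => fderiv ℝ ψ x e) 2 (vol Ω) :=
  ((continuous_fderiv_test ψ).clm_apply continuous_const).memLp_of_hasCompactSupport
    (ψ.hasCompactSupport.fderiv_apply ℝ e)

/-- The weak gradient satisfies the integration by parts formula. -/
theorem inner_grad_test (ψ : 𝓓(Ω, ℝ)) (e : EuclideanSpace ℝ (Fin n)) (v : H10 Ω) :
    inner ℝ ((memLp_smul_const ψ e).toLp _) (gradL Ω v) =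
      -inner ℝ ((memLp_fderiv_apply ψ e).toLp _) (fnL Ω v) := by
  refine H10_induction (p := fun v => inner ℝ ((memLp_smul_const ψ e).toLp _) (gradL Ω v) =
      -inner ℝ ((memLp_fderiv_apply ψ e).toLp _) (fnL Ω v)) ?_ ?_ v
  · exact isClosed_eq (by fun_prop) (by fun_prop)
  · intro φ v h1 h2
    rw [L2.inner_def, L2.inner_def]
    have e1 : ∫ x, inner ℝ ((memLp_smul_const ψ e).toLp _ x) (gradL Ω v x) ∂(vol Ω) =
        ∫ x, ψ x * fderiv ℝ φ x e ∂(vol Ω) := by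
      apply integral_congr_ae
      filter_upwards [(memLp_smul_const ψ e).coeFn_toLp, h2] with x hx hx2
      rw [hx, gradL_apply, hx2, real_inner_smul_left, real_inner_comm, gradient,
        InnerProductSpace.toDual_symm_apply]
    have e2 : ∫ x, inner ℝ ((memLp_fderiv_apply ψ e).toLp _ x) (fnL Ω v x) ∂(vol Ω) =
        ∫ x, fderiv ℝ ψ x e * φ x ∂(vol Ω) := by
      apply integral_congr_ae
      filter_upwards [(memLp_fderiv_apply ψ e).coeFn_toLp, h1] with x hx hx2
      rw [hx, fnL_apply, hx2]
      simp [mul_comm]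
    -- Test functions vanish off `Ω`, so the integrals pass to the whole space and no boundary term
    -- arises.
    rw [e1, e2, setIntegral_eq_integral_of_forall_compl_eq_zero,
      setIntegral_eq_integral_of_forall_compl_eq_zero]
    · have cφ := (continuous_fderiv_test φ).clm_apply (continuous_const (y := e))
      have cψ := (continuous_fderiv_test ψ).clm_apply (continuous_const (y := e))
      apply integral_mul_fderiv_eq_neg_fderiv_mul_of_integrable
      · exact (cψ.mul φ.continuous).integrable_of_hasCompactSupport
          φ.hasCompactSupport.mul_left
      · exact (ψ.continuous.mul cφ).integrable_of_hasCompactSupport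
          ψ.hasCompactSupport.mul_right
      · exact (ψ.continuous.mul φ.continuous).integrable_of_hasCompactSupport
          ψ.hasCompactSupport.mul_right
      · exact fun x _ => ψ.contDiff.differentiable (by simp) x
      · exact fun x _ => φ.contDiff.differentiable (by simp) x
    · intro x hx
      rw [Function.notMem_support.1 fun h => hx (support_subset φ h), mul_zero]
    · intro x hx
      rw [Function.notMem_support.1 fun h => hx (support_subset ψ h), zero_mul]

/-- Elements of `H¹₀(Ω)` are pairs (function, gradient), so `u ≠ 0` must be shown to mean a nonzero
function. Integration by parts makes the gradient orthogonal to all test fields when the function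
vanishes, hence zero a.e. -/
theorem eq_zero_of_fn_eq_zero {v : H10 Ω} (h : fn v = 0) : v = 0 := by
  refine eq_zero_of_fn_grad h ?_
  have hloc : LocallyIntegrableOn (grad v) (Ω : Set (EuclideanSpace ℝ (Fin n))) (vol Ω) :=
    ((Lp.memLp (grad v)).locallyIntegrable (by norm_num)).locallyIntegrableOn _
  have key := IsOpen.ae_eq_zero_of_integral_contDiff_smul_eq_zero Ω.isOpen hloc ?_
  · rw [Lp.eq_zero_iff_ae_eq_zero]
    filter_upwards [key, ae_restrict_mem Ω.isOpen.measurableSet] with x hx hxΩ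
    exact hx hxΩ
  · intro g hg hgc hgs
    set ψ : 𝓓(Ω, ℝ) := ⟨g, hg, hgc, hgs⟩
    have hint : Integrable (fun x => g x • grad v x) (vol Ω) := by
      have : MemLp g 2 (vol Ω) := hg.continuous.memLp_of_hasCompactSupport hgc
      exact memLp_one_iff_integrable.1 ((Lp.memLp (grad v)).smul this)
    refine ext_inner_left ℝ fun e => ?_
    rw [← integral_inner hint, inner_zero_right]
    have h1 := inner_grad_test ψ e v
    rw [fnL_apply, h, inner_zero_right, neg_zero, L2.inner_def] at h1
    rw [← h1]
    apply integral_congr_ae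
    filter_upwards [(memLp_smul_const ψ e).coeFn_toLp] with x hx
    rw [hx, gradL_apply, real_inner_smul_left, real_inner_smul_right]
    rfl

theorem critNorm_pos (hn : 3 ≤ n) {u : H10 Ω} (hu : u ≠ 0) : 0 < critNorm u := by
  refine lt_of_le_of_ne lpNorm_nonneg fun h0 => hu (eq_zero_of_fn_eq_zero ?_)
  have h1 := ofReal_lpNorm (memLp_critExp hn u)
  rw [show lpNorm (fn u) (ENNReal.ofReal (critExp n)) (vol Ω) = 0 from h0.symm,
    ENNReal.ofReal_zero] at h1
  rw [Lp.eq_zero_iff_ae_eq_zero]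
  exact (eLpNorm_eq_zero_iff (Lp.aestronglyMeasurable _)
    (by simpa using critExp_pos hn)).1 h1.symm

end Basic

/-! ### Poincaré inequality on a grid of cubes. -/

section Poincare

variable {n : ℕ} {Ω : Opens (EuclideanSpace ℝ (Fin n))}

/-- The increment is the integral of the derivative along the segment; Jensen on `[0, 1]` moves the
square inside. -/
theorem sq_sub_translate_le {f : EuclideanSpace ℝ (Fin n) → ℝ} (hf : ContDiff ℝ 1 f)
    (x h : EuclideanSpace ℝ (Fin n)) :
    (f (x + h) - f x) ^ 2 ≤ ∫ t in Set.Ioc (0 : ℝ) 1, ‖h‖ ^ 2 * ‖fderiv ℝ f (x + t • h)‖ ^ 2 := by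
  have hc : Continuous fun t : ℝ => fderiv ℝ f (x + t • h) h :=
    ((hf.continuous_fderiv (by simp)).comp (by fun_prop)).clm_apply continuous_const
  have hc' : Continuous fun t : ℝ => fderiv ℝ f (x + t • h) :=
    (hf.continuous_fderiv (by simp)).comp (by fun_prop)
  have hint : ∀ g : ℝ → ℝ, Continuous g → IntegrableOn g (Set.Ioc 0 1) := fun g hg =>
    (hg.integrableOn_Icc (a := 0) (b := 1)).mono_set Set.Ioc_subset_Icc_self
  have h1 : ∫ t in (0 : ℝ)..1, fderiv ℝ f (x + t • h) h = f (x + h) - f x := by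
    have := intervalIntegral.integral_eq_sub_of_hasDerivAt (a := 0) (b := 1)
      (f := fun t : ℝ => f (x + t • h)) (f' := fun t : ℝ => fderiv ℝ f (x + t • h) h) ?_
      (hc.intervalIntegrable 0 1)
    · simpa using this
    · intro t _
      have hd : HasDerivAt (fun t : ℝ => x + t • h) h t := by
        simpa using ((hasDerivAt_id t).smul_const h).const_add x
      exact ((hf.differentiable (by simp)) (x + t • h)).hasFDerivAt.comp_hasDerivAt t hd
  rw [intervalIntegral.integral_of_le zero_le_one] at h1
  have : IsProbabilityMeasure (volume.restrict (Set.Ioc (0 : ℝ) 1)) := ⟨by simp⟩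
  have h2 := (even_two.convexOn_pow (𝕜 := ℝ)).map_integral_le
    (μ := volume.restrict (Set.Ioc (0 : ℝ) 1)) (f := fun t : ℝ => fderiv ℝ f (x + t • h) h)
    (continuous_pow 2).continuousOn isClosed_univ (.of_forall fun _ => Set.mem_univ _)
    (hint _ hc) (hint _ (hc.pow 2))
  rw [← h1]
  refine h2.trans (integral_mono (hint _ (hc.pow 2))
    (hint _ (continuous_const.mul (hc'.norm.pow 2))) fun t => ?_)
  have h3 := (fderiv ℝ f (x + t • h)).le_opNorm h
  have h4 : |fderiv ℝ f (x + t • h) h| ^ 2 ≤ (‖fderiv ℝ f (x + t • h)‖ * ‖h‖) ^ 2 :=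
    pow_le_pow_left₀ (abs_nonneg _) h3 2
  rw [sq_abs] at h4
  change (fderiv ℝ f (x + t • h) h) ^ 2 ≤ ‖h‖ ^ 2 * ‖fderiv ℝ f (x + t • h)‖ ^ 2
  linarith [mul_pow ‖fderiv ℝ f (x + t • h)‖ ‖h‖ 2]

/-- Translations by `h` move a function by at most `‖h‖ ‖∇f‖₂` in `L²`. -/
theorem lintegral_sq_sub_translate_le {f : EuclideanSpace ℝ (Fin n) → ℝ} (hf : ContDiff ℝ 1 f)
    (h : EuclideanSpace ℝ (Fin n)) :
    ∫⁻ x, ENNReal.ofReal ((f (x + h) - f x) ^ 2) ≤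
      ENNReal.ofReal (‖h‖ ^ 2) * ∫⁻ x, ENNReal.ofReal (‖fderiv ℝ f x‖ ^ 2) := by
  have hcf := hf.continuous_fderiv (by simp : (1 : ℕ∞ω) ≠ 0)
  calc ∫⁻ x, ENNReal.ofReal ((f (x + h) - f x) ^ 2)
      ≤ ∫⁻ x, ∫⁻ t in Set.Ioc (0 : ℝ) 1,
          ENNReal.ofReal (‖h‖ ^ 2) * ENNReal.ofReal (‖fderiv ℝ f (x + t • h)‖ ^ 2) := by
        refine lintegral_mono fun x => ?_
        refine (ENNReal.ofReal_le_ofReal (sq_sub_translate_le hf x h)).trans ?_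
        rw [ofReal_integral_eq_lintegral_ofReal]
        · exact (lintegral_congr fun t => ENNReal.ofReal_mul (by positivity)).le
        · have : Continuous fun t : ℝ => ‖h‖ ^ 2 * ‖fderiv ℝ f (x + t • h)‖ ^ 2 :=
            continuous_const.mul ((hcf.comp (by fun_prop)).norm.pow 2)
          exact (this.integrableOn_Icc (a := 0) (b := 1)).mono_set Set.Ioc_subset_Icc_self
        · exact .of_forall fun t => by positivity
    _ = ∫⁻ t in Set.Ioc (0 : ℝ) 1, ∫⁻ x,
          ENNReal.ofReal (‖h‖ ^ 2) * ENNReal.ofReal (‖fderiv ℝ f (x + t • h)‖ ^ 2) := by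
        apply lintegral_lintegral_swap
        apply Continuous.aemeasurable
        apply (ENNReal.continuous_const_mul ENNReal.ofReal_ne_top).comp
        exact ENNReal.continuous_ofReal.comp ((hcf.comp (by fun_prop)).norm.pow 2)
    _ = ∫⁻ t in Set.Ioc (0 : ℝ) 1, ENNReal.ofReal (‖h‖ ^ 2) *
          ∫⁻ x, ENNReal.ofReal (‖fderiv ℝ f x‖ ^ 2) := by
        refine lintegral_congr fun t => ?_
        rw [lintegral_const_mul' _ _ ENNReal.ofReal_ne_top,
          lintegral_add_right_eq_self (fun x => ENNReal.ofReal (‖fderiv ℝ f x‖ ^ 2))]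
    _ = _ := by simp

theorem integrable_norm_sq {F : Type*} [NormedAddCommGroup F]
    {f : EuclideanSpace ℝ (Fin n) → F} (hf : Continuous f) (hfc : HasCompactSupport f) :
    Integrable fun x => ‖f x‖ ^ 2 := by
  refine (hf.norm.pow 2).integrable_of_hasCompactSupport (HasCompactSupport.intro hfc.isCompact ?_)
  intro x hx
  change ‖f x‖ ^ 2 = 0
  rw [image_eq_zero_of_notMem_tsupport hx, norm_zero, zero_pow two_ne_zero]

theorem integrable_sq {f : EuclideanSpace ℝ (Fin n) → ℝ} (hf : Continuous f)
    (hfc : HasCompactSupport f) : Integrable fun x => f x ^ 2 := by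
  simpa using integrable_norm_sq hf hfc

/-- The variance identity, obtained by expanding the square. Nonnegativity is recorded because
`ENNReal.ofReal` truncates, and the identities over several cubes have to be summed as real numbers.
-/
theorem lintegral_lintegral_sq_sub {f : EuclideanSpace ℝ (Fin n) → ℝ} (hf : Continuous f)
    (hfc : HasCompactSupport f) {Q : Set (EuclideanSpace ℝ (Fin n))} (hQ : volume Q ≠ ⊤) :
    0 ≤ 2 * volume.real Q * (∫ x in Q, f x ^ 2) - 2 * (∫ x in Q, f x) ^ 2 ∧
    ∫⁻ x in Q, ∫⁻ y in Q, ENNReal.ofReal ((f x - f y) ^ 2) =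
      ENNReal.ofReal (2 * volume.real Q * (∫ x in Q, f x ^ 2) - 2 * (∫ x in Q, f x) ^ 2) := by
  have hfin : IsFiniteMeasure (volume.restrict Q) := ⟨by simpa using hQ.lt_top⟩
  have i1 : Integrable f (volume.restrict Q) :=
    (hf.integrable_of_hasCompactSupport hfc).restrict
  have i2 : Integrable (fun x => f x ^ 2) (volume.restrict Q) :=
    (integrable_sq hf hfc).restrict
  have quad_int : ∀ a b c : ℝ,
      Integrable (fun x => a * f x ^ 2 + b * f x + c) (volume.restrict Q) := fun a b c =>
    ((i2.const_mul a).add (i1.const_mul b)).add (integrable_const c)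
  have quad : ∀ a b c : ℝ, ∫ x in Q, (a * f x ^ 2 + b * f x + c) =
      a * (∫ x in Q, f x ^ 2) + b * (∫ x in Q, f x) + c * volume.real Q := by
    intro a b c
    have j1 : Integrable (fun x => a * f x ^ 2 + b * f x) (volume.restrict Q) :=
      (i2.const_mul a).add (i1.const_mul b)
    rw [integral_add j1 (integrable_const c), integral_add (i2.const_mul a) (i1.const_mul b),
      integral_const_mul, integral_const_mul, integral_const, measureReal_restrict_apply_univ,
      smul_eq_mul, mul_comm c]
  have expand : ∀ x, (fun y => (f x - f y) ^ 2) =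
      fun y => 1 * f y ^ 2 + (-2 * f x) * f y + f x ^ 2 := fun x => by
    funext y; ring
  have inner_eq : ∀ x, ∫ y in Q, (f x - f y) ^ 2 =
      volume.real Q * f x ^ 2 + (-2 * ∫ y in Q, f y) * f x + ∫ y in Q, f y ^ 2 := by
    intro x
    rw [expand, quad]
    ring
  have i3 : ∀ x, Integrable (fun y => (f x - f y) ^ 2) (volume.restrict Q) := by
    intro x
    rw [expand]
    exact quad_int _ _ _
  have e1 : ∀ x, ∫⁻ y in Q, ENNReal.ofReal ((f x - f y) ^ 2) =
      ENNReal.ofReal (volume.real Q * f x ^ 2 + (-2 * ∫ y in Q, f y) * f x + ∫ y in Q, f y ^ 2) := by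
    intro x
    rw [← inner_eq, ofReal_integral_eq_lintegral_ofReal (i3 x) (.of_forall fun y => sq_nonneg _)]
  have i4 : Integrable (fun x => volume.real Q * f x ^ 2 + (-2 * ∫ y in Q, f y) * f x +
      ∫ y in Q, f y ^ 2) (volume.restrict Q) :=
    quad_int _ _ _
  have hnn : ∀ x, 0 ≤ volume.real Q * f x ^ 2 + (-2 * ∫ y in Q, f y) * f x +
      ∫ y in Q, f y ^ 2 := by
    intro x
    rw [← inner_eq]
    exact integral_nonneg fun y => sq_nonneg _
  have e2 : ∫ x in Q, (volume.real Q * f x ^ 2 + (-2 * ∫ y in Q, f y) * f x +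
      ∫ y in Q, f y ^ 2) =
      2 * volume.real Q * (∫ x in Q, f x ^ 2) - 2 * (∫ x in Q, f x) ^ 2 := by
    rw [quad]
    ring
  rw [lintegral_congr e1, ← ofReal_integral_eq_lintegral_ofReal i4 (.of_forall hnn), e2]
  exact ⟨e2 ▸ integral_nonneg hnn, rfl⟩

/-- The half-open cube of side `r` with index `z` in the standard grid. -/
def cube (r : ℝ) (z : Fin n → ℤ) : Set (EuclideanSpace ℝ (Fin n)) :=
  {x | ∀ i, ⌊x i / r⌋ = z i}

theorem cube_eq_preimage {r : ℝ} (hr : 0 < r) (z : Fin n → ℤ) :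
    cube r z = (@WithLp.ofLp 2 (Fin n → ℝ)) ⁻¹'
      (Set.univ.pi fun i => Set.Ico (z i * r) ((z i + 1) * r)) := by
  ext x
  simp only [cube, Set.mem_ofPred_eq, Set.mem_preimage, Set.mem_pi, Set.mem_univ, true_imp_iff,
    Set.mem_Ico]
  refine forall_congr' fun i => ?_
  rw [Int.floor_eq_iff, le_div_iff₀ hr, div_lt_iff₀ hr]

theorem measurableSet_cube {r : ℝ} (hr : 0 < r) (z : Fin n → ℤ) : MeasurableSet (cube r z) := by
  rw [cube_eq_preimage hr]
  exact (PiLp.volume_preserving_ofLp (Fin n)).measurable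
    (MeasurableSet.univ_pi fun _ => measurableSet_Ico)

theorem volume_cube {r : ℝ} (hr : 0 < r) (z : Fin n → ℤ) :
    volume (cube r z) = ENNReal.ofReal (r ^ n) := by
  rw [cube_eq_preimage hr, (PiLp.volume_preserving_ofLp (Fin n)).measure_preimage
    (MeasurableSet.univ_pi fun _ => measurableSet_Ico).nullMeasurableSet, Real.volume_pi_Ico]
  have : ∀ i : Fin n, ((z i : ℝ) + 1) * r - z i * r = r := fun i => by ring
  simp [this, ENNReal.ofReal_pow hr.le]

theorem pairwiseDisjoint_cube (r : ℝ) (s : Set (Fin n → ℤ)) : s.PairwiseDisjoint (cube r) := by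
  intro z _ z' _ hne
  refine Set.disjoint_left.2 fun x hx hx' => hne ?_
  funext i
  rw [← hx i, ← hx' i]

theorem norm_sub_le_of_mem_cube {r : ℝ} (hr : 0 < r) {z : Fin n → ℤ}
    {x y : EuclideanSpace ℝ (Fin n)} (hx : x ∈ cube r z) (hy : y ∈ cube r z) :
    ‖y - x‖ ≤ r * √n := by
  have h1 : ∀ i, ‖(y - x) i‖ ^ 2 ≤ r ^ 2 := by
    intro i
    rw [cube_eq_preimage hr] at hx hy
    have h1 := hx i (Set.mem_univ _)
    have h2 := hy i (Set.mem_univ _)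
    rw [Set.mem_Ico] at h1 h2
    rw [Real.norm_eq_abs, sq_abs, PiLp.sub_apply]
    apply sq_le_sq' <;> linarith [h1.1, h1.2, h2.1, h2.2]
  rw [EuclideanSpace.norm_eq]
  calc √(∑ i, ‖(y - x) i‖ ^ 2) ≤ √(∑ _i : Fin n, r ^ 2) :=
        Real.sqrt_le_sqrt (Finset.sum_le_sum fun i _ => h1 i)
    _ = r * √n := by
        rw [Finset.sum_const, Finset.card_univ, Fintype.card_fin, nsmul_eq_mul, mul_comm,
          Real.sqrt_mul (by positivity), Real.sqrt_sq hr.le]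

theorem exists_finset_cube_cover {S : Set (EuclideanSpace ℝ (Fin n))} (hS : Bornology.IsBounded S)
    {r : ℝ} (hr : 0 < r) : ∃ J : Finset (Fin n → ℤ), S ⊆ ⋃ z ∈ J, cube r z := by
  obtain ⟨R, hR⟩ := hS.exists_norm_le
  refine ⟨Fintype.piFinset fun _ => Finset.Icc ⌊-R / r⌋ ⌊R / r⌋, fun x hx => ?_⟩
  simp only [Set.mem_iUnion]
  refine ⟨fun i => ⌊x i / r⌋, ?_, fun i => rfl⟩
  rw [Fintype.mem_piFinset]
  intro i
  have h1 : |x i| ≤ R := (PiLp.norm_apply_le x i).trans (hR x hx)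
  rw [abs_le] at h1
  rw [Finset.mem_Icc]
  constructor
  · exact Int.floor_le_floor (div_le_div_of_nonneg_right h1.1 hr.le)
  · exact Int.floor_le_floor (div_le_div_of_nonneg_right h1.2 hr.le)

/-- Two points of one cube differ by some `h` with `‖h‖ ≤ r √n`. The cubes being disjoint, the sum
is at most the integral over such `h` of the squared `L²` distance between `f` and its translate.
The bound does not depend on `J`. -/
theorem sum_lintegral_cube_le {f : EuclideanSpace ℝ (Fin n) → ℝ} (hf : ContDiff ℝ 1 f) {r : ℝ}
    (hr : 0 < r) (J : Finset (Fin n → ℤ)) :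
    ∑ z ∈ J, ∫⁻ x in cube r z, ∫⁻ y in cube r z, ENNReal.ofReal ((f x - f y) ^ 2) ≤
      ENNReal.ofReal (r ^ n) * volume (Metric.closedBall (0 : EuclideanSpace ℝ (Fin n)) √n) *
        (ENNReal.ofReal ((r * √n) ^ 2) * ∫⁻ x, ENNReal.ofReal (‖fderiv ℝ f x‖ ^ 2)) := by
  have hfc := hf.continuous
  set B := Metric.closedBall (0 : EuclideanSpace ℝ (Fin n)) (r * √n) with hB
  have hBm : MeasurableSet B := Metric.isClosed_closedBall.measurableSet
  have hvB : volume B = ENNReal.ofReal (r ^ n) *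
      volume (Metric.closedBall (0 : EuclideanSpace ℝ (Fin n)) √n) := by
    rw [hB, Measure.addHaar_closedBall_mul _ _ hr.le (Real.sqrt_nonneg _),
      finrank_euclideanSpace_fin]
  set G : EuclideanSpace ℝ (Fin n) → ℝ≥0∞ := fun x =>
    ∫⁻ h in B, ENNReal.ofReal ((f (x + h) - f x) ^ 2) with hG
  calc _ ≤ ∑ z ∈ J, ∫⁻ x in cube r z, G x := by
        refine Finset.sum_le_sum fun z _ => ?_
        refine setLIntegral_mono' (measurableSet_cube hr z) fun x hx => ?_
        rw [hG, ← lintegral_indicator (measurableSet_cube hr z)]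
        simp only
        -- Substitute `y = h + x`; if `y` is in the cube of `x` then `h` is in `B`, so the
        -- indicators compare pointwise.
        rw [← lintegral_indicator hBm, ← lintegral_add_right_eq_self _ x]
        refine lintegral_mono fun h => ?_
        by_cases hy : h + x ∈ cube r z
        · have hh : h ∈ B := by
            rw [hB, mem_closedBall_zero_iff]
            simpa using norm_sub_le_of_mem_cube hr hx hy
          rw [Set.indicator_of_mem hy, Set.indicator_of_mem hh, add_comm h x]
          apply ENNReal.ofReal_le_ofReal
          apply le_of_eq
          ring
        · rw [Set.indicator_of_notMem hy]
          exact zero_le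
    _ = ∫⁻ x in ⋃ z ∈ J, cube r z, G x :=
        (lintegral_biUnion_finset (pairwiseDisjoint_cube r _)
          (fun z _ => measurableSet_cube hr z) G).symm
    _ ≤ ∫⁻ x, G x := setLIntegral_le_lintegral _ _
    _ = ∫⁻ h in B, ∫⁻ x, ENNReal.ofReal ((f (x + h) - f x) ^ 2) := by
        apply lintegral_lintegral_swap
        apply Continuous.aemeasurable
        exact ENNReal.continuous_ofReal.comp (by fun_prop)
    _ ≤ ∫⁻ h in B, ENNReal.ofReal ((r * √n) ^ 2) *
          ∫⁻ x, ENNReal.ofReal (‖fderiv ℝ f x‖ ^ 2) := by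
        refine setLIntegral_mono' hBm fun h hh => ?_
        refine (lintegral_sq_sub_translate_le hf h).trans ?_
        gcongr
        simpa [hB] using hh
    _ = _ := by
        rw [setLIntegral_const, hvB, mul_comm]

theorem integral_sq_eq_norm_sq (g : Lp ℝ 2 (vol Ω)) : ∫ x, g x ^ 2 ∂(vol Ω) = ‖g‖ ^ 2 := by
  rw [← real_inner_self_eq_norm_sq, L2.inner_def]
  simp [sq]

theorem integral_norm_sq_eq_norm_sq (g : Lp (EuclideanSpace ℝ (Fin n)) 2 (vol Ω)) :
    ∫ x, ‖g x‖ ^ 2 ∂(vol Ω) = ‖g‖ ^ 2 := by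
  rw [← real_inner_self_eq_norm_sq, L2.inner_def]
  simp

/-- The functional `g ↦ ∫_{Q ∩ Ω} g`, where `Q` is a grid cube. -/
def cubeFunctional (Ω : Opens (EuclideanSpace ℝ (Fin n))) {r : ℝ} (hr : 0 < r) (z : Fin n → ℤ) :
    Lp ℝ 2 (vol Ω) →L[ℝ] ℝ :=
  innerSL ℝ (indicatorConstLp 2 (measurableSet_cube hr z)
    (((Measure.restrict_apply_le _ _).trans_lt
      (by rw [volume_cube hr]; exact ENNReal.ofReal_lt_top)).ne) (1 : ℝ))

theorem cubeFunctional_apply {r : ℝ} (hr : 0 < r) (z : Fin n → ℤ) (g : Lp ℝ 2 (vol Ω)) :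
    cubeFunctional Ω hr z g = ∫ x in cube r z, g x ∂(vol Ω) := by
  rw [cubeFunctional, innerSL_apply_apply]
  exact L2.inner_indicatorConstLp_one _ _ g

theorem test_eq_zero (φ : 𝓓(Ω, ℝ)) {x : EuclideanSpace ℝ (Fin n)}
    (hx : x ∉ (Ω : Set (EuclideanSpace ℝ (Fin n)))) : φ x = 0 :=
  Function.notMem_support.1 fun h => hx (support_subset φ h)

theorem fderiv_test_eq_zero (φ : 𝓓(Ω, ℝ)) {x : EuclideanSpace ℝ (Fin n)}
    (hx : x ∉ (Ω : Set (EuclideanSpace ℝ (Fin n)))) : fderiv ℝ φ x = 0 :=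
  Function.notMem_support.1 fun h => hx (support_fderiv_subset φ h)

theorem norm_fnL_sq_eq_sum {r : ℝ} (hr : 0 < r) {J : Finset (Fin n → ℤ)}
    (hJ : (Ω : Set (EuclideanSpace ℝ (Fin n))) ⊆ ⋃ z ∈ J, cube r z) {v : H10 Ω} {φ : 𝓓(Ω, ℝ)}
    (h : fn v =ᵐ[vol Ω] φ) : ‖fnL Ω v‖ ^ 2 = ∑ z ∈ J, ∫ x in cube r z, φ x ^ 2 := by
  have h0 : ∫ x, fnL Ω v x ^ 2 ∂(vol Ω) = ∫ x, φ x ^ 2 ∂(vol Ω) := by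
    apply integral_congr_ae
    filter_upwards [h] with x hx
    rw [fnL_apply, hx]
  have h1 : ∫ x, φ x ^ 2 ∂(vol Ω) = ∫ x, φ x ^ 2 :=
    setIntegral_eq_integral_of_forall_compl_eq_zero fun x hx => by simp [test_eq_zero φ hx]
  have h2 : ∫ x in ⋃ z ∈ J, cube r z, φ x ^ 2 = ∫ x, φ x ^ 2 :=
    setIntegral_eq_integral_of_forall_compl_eq_zero fun x hx => by
      simp [test_eq_zero φ fun h => hx (hJ h)]
  rw [← integral_sq_eq_norm_sq, h0, h1, ← h2]
  refine integral_biUnion_finset J (fun z _ => measurableSet_cube hr z)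
    (pairwiseDisjoint_cube r _) fun z _ => ?_
  exact (integrable_sq φ.continuous φ.hasCompactSupport).integrableOn

theorem cubeFunctional_eq_integral {r : ℝ} (hr : 0 < r) (z : Fin n → ℤ) {v : H10 Ω}
    {φ : 𝓓(Ω, ℝ)} (h : fn v =ᵐ[vol Ω] φ) :
    cubeFunctional Ω hr z (fnL Ω v) = ∫ x in cube r z, φ x := by
  have h0 : ∫ x in cube r z, fnL Ω v x ∂(vol Ω) = ∫ x in cube r z, φ x ∂(vol Ω) := by
    apply integral_congr_ae
    filter_upwards [ae_restrict_of_ae h] with x hx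
    rw [fnL_apply, hx]
  have h1 : (vol Ω).restrict (cube r z) =
      (volume.restrict (cube r z)).restrict (Ω : Set (EuclideanSpace ℝ (Fin n))) := by
    rw [vol, Measure.restrict_restrict (measurableSet_cube hr z), Set.inter_comm,
      Measure.restrict_restrict Ω.isOpen.measurableSet]
  rw [cubeFunctional_apply, h0, h1]
  exact setIntegral_eq_integral_of_forall_compl_eq_zero fun x hx => test_eq_zero φ hx

theorem ofReal_norm_gradL_sq {v : H10 Ω} {φ : 𝓓(Ω, ℝ)} (h : grad v =ᵐ[vol Ω] ∇ (φ : _ → ℝ)) :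
    ENNReal.ofReal (‖gradL Ω v‖ ^ 2) = ∫⁻ x, ENNReal.ofReal (‖fderiv ℝ φ x‖ ^ 2) := by
  have h0 : ∫ x, ‖gradL Ω v x‖ ^ 2 ∂(vol Ω) = ∫ x, ‖fderiv ℝ φ x‖ ^ 2 ∂(vol Ω) := by
    apply integral_congr_ae
    filter_upwards [h] with x hx
    rw [gradL_apply, hx, norm_gradient]
  have h1 : ∫ x, ‖fderiv ℝ φ x‖ ^ 2 ∂(vol Ω) = ∫ x, ‖fderiv ℝ φ x‖ ^ 2 :=
    setIntegral_eq_integral_of_forall_compl_eq_zero fun x hx => by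
      simp [fderiv_test_eq_zero φ hx]
  rw [← integral_norm_sq_eq_norm_sq, h0, h1]
  refine ofReal_integral_eq_lintegral_ofReal ?_ (.of_forall fun x => by positivity)
  exact integrable_norm_sq (continuous_fderiv_test φ) (φ.hasCompactSupport.fderiv ℝ)

/-- A Poincaré inequality on `H¹₀(Ω)` with correction terms given by the means on the cubes of a
grid. -/
theorem poincare_cubes {r : ℝ} (hr : 0 < r) {J : Finset (Fin n → ℤ)}
    (hJ : (Ω : Set (EuclideanSpace ℝ (Fin n))) ⊆ ⋃ z ∈ J, cube r z) (v : H10 Ω) :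
    2 * r ^ n * ‖fnL Ω v‖ ^ 2 ≤ 2 * ∑ z ∈ J, (cubeFunctional Ω hr z (fnL Ω v)) ^ 2 +
      r ^ n * volume.real (Metric.closedBall (0 : EuclideanSpace ℝ (Fin n)) √n) *
        ((r * √n) ^ 2 * ‖gradL Ω v‖ ^ 2) := by
  refine H10_induction (p := fun v => 2 * r ^ n * ‖fnL Ω v‖ ^ 2 ≤
    2 * ∑ z ∈ J, (cubeFunctional Ω hr z (fnL Ω v)) ^ 2 +
      r ^ n * volume.real (Metric.closedBall (0 : EuclideanSpace ℝ (Fin n)) √n) *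
        ((r * √n) ^ 2 * ‖gradL Ω v‖ ^ 2)) ?_ ?_ v
  · exact isClosed_le (by fun_prop) (by fun_prop)
  intro φ v h1 h2
  have hvr : ∀ z : Fin n → ℤ, volume.real (cube r z) = r ^ n := fun z => by
    rw [Measure.real, volume_cube hr, ENNReal.toReal_ofReal (by positivity)]
  have key := sum_lintegral_cube_le (φ.contDiff.of_le (by simp)) hr J
  have hcell := fun z : Fin n → ℤ => lintegral_lintegral_sq_sub φ.continuous φ.hasCompactSupport
    (Q := cube r z) (by rw [volume_cube hr]; exact ENNReal.ofReal_ne_top)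
  have hball : volume (Metric.closedBall (0 : EuclideanSpace ℝ (Fin n)) √n) = ENNReal.ofReal
      (volume.real (Metric.closedBall (0 : EuclideanSpace ℝ (Fin n)) √n)) :=
    (ENNReal.ofReal_toReal
      (isCompact_closedBall (0 : EuclideanSpace ℝ (Fin n)) √n).measure_ne_top).symm
  have hκ : 0 ≤ volume.real (Metric.closedBall (0 : EuclideanSpace ℝ (Fin n)) √n) :=
    measureReal_nonneg
  rw [← ofReal_norm_gradL_sq h2, Finset.sum_congr rfl fun z _ => (hcell z).2,
    ← ENNReal.ofReal_sum_of_nonneg fun z _ => (hcell z).1, hball,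
    ← ENNReal.ofReal_mul (by positivity), ← ENNReal.ofReal_mul (by positivity),
    ← ENNReal.ofReal_mul (by positivity), ENNReal.ofReal_le_ofReal_iff (by positivity)] at key
  simp only [hvr, Finset.sum_sub_distrib, ← Finset.mul_sum, ← norm_fnL_sq_eq_sum hr hJ h1,
    ← cubeFunctional_eq_integral hr _ h1] at key
  linarith [key]

/-- Finitely many linear conditions on `v ∈ H¹₀(Ω)`, with `Ω` bounded, make the ratio
`‖v‖₂ / ‖∇v‖₂` arbitrarily small. -/
theorem exists_functionals_norm_le (hΩ : Bornology.IsBounded (Ω : Set (EuclideanSpace ℝ (Fin n))))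
    {δ : ℝ} (hδ : 0 < δ) : ∃ (J : Finset (Fin n → ℤ)) (l : (Fin n → ℤ) → (Lp ℝ 2 (vol Ω) →L[ℝ] ℝ)),
      ∀ v : H10 Ω, (∀ z ∈ J, l z (fnL Ω v) = 0) → ‖fnL Ω v‖ ^ 2 ≤ δ * ‖gradL Ω v‖ ^ 2 := by
  set κ := volume.real (Metric.closedBall (0 : EuclideanSpace ℝ (Fin n)) √n) with hκ
  have hκ0 : 0 ≤ κ := measureReal_nonneg
  -- When all cube means vanish, `poincare_cubes` reads `2 ‖v‖₂² ≤ κ (r √n)² ‖∇v‖₂²` after division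
  -- by `r ^ n`; `r` is chosen for this.
  obtain ⟨r, hr, hrδ⟩ : ∃ r : ℝ, 0 < r ∧ κ * (r * √n) ^ 2 ≤ 2 * δ := by
    have hc : Filter.Tendsto (fun r : ℝ => κ * (r * √n) ^ 2) (nhdsWithin 0 (Set.Ioi 0))
        (nhds 0) := by
      have : Continuous (fun r : ℝ => κ * (r * √n) ^ 2) := by fun_prop
      simpa using (this.tendsto 0).mono_left nhdsWithin_le_nhds
    obtain ⟨r, h1, h2⟩ := ((hc.eventually (ge_mem_nhds (by linarith : (0 : ℝ) < 2 * δ))).and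
      self_mem_nhdsWithin).exists
    exact ⟨r, h2, h1⟩
  obtain ⟨J, hJ⟩ := exists_finset_cube_cover hΩ hr
  refine ⟨J, cubeFunctional Ω hr, fun v hv => ?_⟩
  have h1 := poincare_cubes hr hJ v
  rw [Finset.sum_eq_zero fun z hz => by rw [hv z hz]; simp, mul_zero, zero_add, ← hκ] at h1
  have hrn : 0 < r ^ n := by positivity
  have h2 : r ^ n * (2 * ‖fnL Ω v‖ ^ 2) ≤ r ^ n * (κ * (r * √n) ^ 2 * ‖gradL Ω v‖ ^ 2) := by
    linarith
  have h3 := le_of_mul_le_mul_left h2 hrn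
  have h4 := mul_le_mul_of_nonneg_right hrδ (sq_nonneg ‖gradL Ω v‖)
  linarith

end Poincare

/-! ### Multiplication by a weight in `Lⁿ(Ω)`. -/

section Weight

variable {n : ℕ} {Ω : Opens (EuclideanSpace ℝ (Fin n))}

/-- The identity `1/n + (n-2)/(2n) = 1/2`, which makes `Lⁿ` the right space for the square root `g`
of the weight. -/
theorem holderTriple_critExp (hn : 3 ≤ n) :
    ENNReal.HolderTriple (ENNReal.ofReal n) (ENNReal.ofReal (critExp n)) 2 := by
  have hn' : (3 : ℝ) ≤ n := by exact_mod_cast hn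
  refine ⟨?_⟩
  rw [← ENNReal.ofReal_inv_of_pos (by linarith), ← ENNReal.ofReal_inv_of_pos (critExp_pos hn),
    ← ENNReal.ofReal_add (by positivity) (inv_nonneg.2 (critExp_pos hn).le),
    show (2 : ℝ≥0∞) = ENNReal.ofReal 2 by simp, ← ENNReal.ofReal_inv_of_pos (by norm_num)]
  congr 1
  rw [critExp]
  have : (n : ℝ) - 2 ≠ 0 := by linarith
  have : (n : ℝ) ≠ 0 := by linarith
  field_simp
  ring

theorem memLp_weight_mul (hn : 3 ≤ n) {g : EuclideanSpace ℝ (Fin n) → ℝ}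
    (hg : MemLp g (ENNReal.ofReal n) (vol Ω)) (v : H10 Ω) :
    MemLp (fun x => g x * fn v x) 2 (vol Ω) :=
  have := holderTriple_critExp hn
  (memLp_critExp hn v).mul' hg

/-- Multiplication by a function of `Lⁿ(Ω)`, as a linear map from `H¹₀(Ω)` to `L²(Ω)`. -/
def weightLM (hn : 3 ≤ n) {g : EuclideanSpace ℝ (Fin n) → ℝ}
    (hg : MemLp g (ENNReal.ofReal n) (vol Ω)) : H10 Ω →ₗ[ℝ] Lp ℝ 2 (vol Ω) where
  toFun v := (memLp_weight_mul hn hg v).toLp _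
  map_add' v v' := by
    rw [← MemLp.toLp_add]
    apply MemLp.toLp_congr
    filter_upwards [Lp.coeFn_add (fn v) (fn v')] with x hx
    have : fn (v + v') x = fn v x + fn v' x := hx
    simp only [Pi.add_apply, this, mul_add]
  map_smul' c v := by
    rw [RingHom.id_apply, ← MemLp.toLp_const_smul]
    apply MemLp.toLp_congr
    filter_upwards [Lp.coeFn_smul c (fn v)] with x hx
    have : fn (c • v) x = c * fn v x := hx
    simp only [Pi.smul_apply, smul_eq_mul, this, mul_left_comm]

theorem weightLM_ae (hn : 3 ≤ n) {g : EuclideanSpace ℝ (Fin n) → ℝ}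
    (hg : MemLp g (ENNReal.ofReal n) (vol Ω)) (v : H10 Ω) :
    weightLM hn hg v =ᵐ[vol Ω] fun x => g x * fn v x :=
  (memLp_weight_mul hn hg v).coeFn_toLp

theorem exists_norm_weightLM_le (hn : 3 ≤ n) (Ω : Opens (EuclideanSpace ℝ (Fin n))) :
    ∃ C : ℝ, 0 ≤ C ∧ ∀ (g : EuclideanSpace ℝ (Fin n) → ℝ)
      (hg : MemLp g (ENNReal.ofReal n) (vol Ω)) (v : H10 Ω),
      ‖weightLM hn hg v‖ ≤ (eLpNorm g (ENNReal.ofReal n) (vol Ω)).toReal * (C * ‖gradL Ω v‖) := by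
  have := holderTriple_critExp hn
  obtain ⟨C, hC⟩ := exists_sobolev_const hn Ω
  refine ⟨C, C.2, fun g hg v => ?_⟩
  have h1 : eLpNorm (fun x => g x * fn v x) 2 (vol Ω) ≤
      eLpNorm g (ENNReal.ofReal n) (vol Ω) * (C * ENNReal.ofReal ‖gradL Ω v‖) :=
    (eLpNorm_smul_le_mul_eLpNorm (Lp.aestronglyMeasurable (fn v)) hg.1).trans
      (mul_le_mul_right (hC v) _)
  change ‖(memLp_weight_mul hn hg v).toLp _‖ ≤ _
  rw [Lp.norm_toLp]
  refine (ENNReal.toReal_mono ?_ h1).trans_eq ?_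
  · exact ENNReal.mul_ne_top hg.2.ne (ENNReal.mul_ne_top ENNReal.coe_ne_top ENNReal.ofReal_ne_top)
  · rw [ENNReal.toReal_mul, ENNReal.toReal_mul, ENNReal.toReal_ofReal (norm_nonneg _)]
    rfl

theorem continuous_weightLM (hn : 3 ≤ n) {g : EuclideanSpace ℝ (Fin n) → ℝ}
    (hg : MemLp g (ENNReal.ofReal n) (vol Ω)) : Continuous (weightLM hn hg) := by
  obtain ⟨C, hC0, hC⟩ := exists_norm_weightLM_le hn Ω
  refine AddMonoidHomClass.continuous_of_bound (weightLM hn hg)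
    ((eLpNorm g (ENNReal.ofReal n) (vol Ω)).toReal * (C * ‖gradL Ω‖)) fun v => ?_
  refine (hC g hg v).trans ?_
  have h1 := (gradL Ω).le_opNorm v
  have h2 : 0 ≤ (eLpNorm g (ENNReal.ofReal n) (vol Ω)).toReal := ENNReal.toReal_nonneg
  calc _ ≤ (eLpNorm g (ENNReal.ofReal n) (vol Ω)).toReal * (C * (‖gradL Ω‖ * ‖v‖)) := by gcongr
    _ = _ := by ring

/-- The weighted norm is bounded by an arbitrarily small multiple of the gradient norm, up to a
multiple of the `L²` norm. -/
theorem exists_norm_weightLM_sq_le (hn : 3 ≤ n) {g : EuclideanSpace ℝ (Fin n) → ℝ}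
    (hgm : StronglyMeasurable g) (hg : MemLp g (ENNReal.ofReal n) (vol Ω)) {ε : ℝ} (hε : 0 < ε) :
    ∃ A : ℝ, 0 ≤ A ∧ ∀ v : H10 Ω,
      ‖weightLM hn hg v‖ ^ 2 ≤ A * ‖fnL Ω v‖ ^ 2 + ε * ‖gradL Ω v‖ ^ 2 := by
  obtain ⟨C, hC0, hC⟩ := exists_norm_weightLM_le hn Ω
  -- Split `g` at a height `M` so that its part above `M` has `Lⁿ` norm at most `η`. That part is
  -- controlled by Sobolev, the rest by `M ‖v‖₂`; the factors `2` here and in `2 * M ^ 2` come from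
  -- squaring the sum.
  obtain ⟨η, hη, hηε⟩ : ∃ η : ℝ, 0 < η ∧ 2 * (η * C) ^ 2 ≤ ε := by
    have hc : Filter.Tendsto (fun η : ℝ => 2 * (η * C) ^ 2) (nhdsWithin 0 (Set.Ioi 0))
        (nhds 0) := by
      have : Continuous (fun η : ℝ => 2 * (η * C) ^ 2) := by fun_prop
      simpa using (this.tendsto 0).mono_left nhdsWithin_le_nhds
    obtain ⟨r, h1, h2⟩ := ((hc.eventually (ge_mem_nhds hε)).and self_mem_nhdsWithin).exists
    exact ⟨r, h2, h1⟩
  obtain ⟨M, hM⟩ := hg.eLpNorm_indicator_norm_ge_le hgm hη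
  set S : Set (EuclideanSpace ℝ (Fin n)) := {x | M ≤ ‖g x‖₊} with hS
  have hSm : MeasurableSet S := hgm.norm.measurable measurableSet_Ici
  have hg' : MemLp (S.indicator g) (ENNReal.ofReal n) (vol Ω) := hg.indicator hSm
  refine ⟨2 * M ^ 2, by positivity, fun v => ?_⟩
  have hbig : ‖weightLM hn hg' v‖ ≤ η * (C * ‖gradL Ω v‖) := by
    refine (hC _ hg' v).trans ?_
    gcongr
    exact ENNReal.toReal_le_of_le_ofReal hη.le hM
  have hsmall : ‖weightLM hn hg v - weightLM hn hg' v‖ ≤ |M| * ‖fnL Ω v‖ := by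
    apply Lp.norm_le_mul_norm_of_ae_le_mul
    filter_upwards [Lp.coeFn_sub (weightLM hn hg v) (weightLM hn hg' v), weightLM_ae hn hg v,
      weightLM_ae hn hg' v] with x h1 h2 h3
    rw [h1, Pi.sub_apply, h2, h3, ← sub_mul, norm_mul, fnL_apply]
    refine mul_le_mul_of_nonneg_right ?_ (norm_nonneg _)
    by_cases hx : x ∈ S
    · rw [Set.indicator_of_mem hx, sub_self, norm_zero]
      exact abs_nonneg _
    · rw [Set.indicator_of_notMem hx, sub_zero]
      have : ‖g x‖ < M := not_le.1 hx
      exact this.le.trans (le_abs_self _)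
  have htri : ‖weightLM hn hg v‖ ≤ |M| * ‖fnL Ω v‖ + η * C * ‖gradL Ω v‖ := by
    have := norm_add_le (weightLM hn hg v - weightLM hn hg' v) (weightLM hn hg' v)
    rw [sub_add_cancel] at this
    linarith
  have hsq := pow_le_pow_left₀ (norm_nonneg _) htri 2
  have h4 := add_sq_le (a := |M| * ‖fnL Ω v‖) (b := η * C * ‖gradL Ω v‖)
  have h5 := mul_le_mul_of_nonneg_right hηε (sq_nonneg ‖gradL Ω v‖)
  rw [mul_pow, mul_pow _ ‖gradL Ω v‖, sq_abs] at h4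
  linarith

theorem exists_H10_of_test (φ : 𝓓(Ω, ℝ)) :
    ∃ v : H10 Ω, fn v =ᵐ[vol Ω] φ ∧ grad v =ᵐ[vol Ω] ∇ (φ : _ → ℝ) := by
  have h1 : MemLp φ 2 (vol Ω) := φ.continuous.memLp_of_hasCompactSupport φ.hasCompactSupport
  have h2 : MemLp (∇ (φ : _ → ℝ)) 2 (vol Ω) :=
    (continuous_gradient φ).memLp_of_hasCompactSupport (hasCompactSupport_gradient φ)
  exact ⟨⟨WithLp.toLp 2 (h1.toLp _, h2.toLp _), subset_closure
    ⟨φ, h1.coeFn_toLp, h2.coeFn_toLp⟩⟩, h1.coeFn_toLp, h2.coeFn_toLp⟩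

theorem fn_sum_smul_ae {k : ℕ} (a : Fin k → ℝ) (e : Fin k → H10 Ω)
    (φ : Fin k → 𝓓(Ω, ℝ)) (h : ∀ i, fn (e i) =ᵐ[vol Ω] φ i) :
    fn (∑ i, a i • e i) =ᵐ[vol Ω] fun x => ∑ i, a i * φ i x := by
  have h0 : fn (∑ i, a i • e i) = ∑ i, a i • fn (e i) := by
    simp only [← fnL_apply, map_sum, map_smul]
  rw [h0]
  have h1 : ∀ᵐ x ∂(vol Ω), ∀ i, (a i • fn (e i)) x = a i * φ i x := by
    rw [ae_all_iff]
    intro i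
    filter_upwards [Lp.coeFn_smul (a i) (fn (e i)), h i] with x hx hx'
    rw [hx, Pi.smul_apply, hx', smul_eq_mul]
  filter_upwards [Lp.coeFn_finsetSum Finset.univ (fun i => a i • fn (e i)), h1] with x hx hx'
  rw [hx, Finset.sum_apply]
  exact Finset.sum_congr rfl fun i _ => hx' i

/-- Bump functions with disjoint supports, centred at points near which `g` is nonzero on a set of
positive measure, stay independent after multiplication by `g`. -/
theorem exists_linearIndependent_weightLM (hn : 3 ≤ n) {g : EuclideanSpace ℝ (Fin n) → ℝ}
    (hgm : StronglyMeasurable g) (hg : MemLp g (ENNReal.ofReal n) (vol Ω))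
    (hg0 : ¬ g =ᵐ[vol Ω] 0) (k : ℕ) :
    ∃ e : Fin k → H10 Ω, LinearIndependent ℝ fun i => weightLM hn hg (e i) := by
  have : Nonempty (Fin n) := ⟨⟨0, by omega⟩⟩
  have : Nontrivial (EuclideanSpace ℝ (Fin n)) := inferInstance
  set S : Set (EuclideanSpace ℝ (Fin n)) := {x | g x ≠ 0} with hS
  have hSm : MeasurableSet S := hgm.measurable (measurableSet_singleton 0).compl
  set ν := (vol Ω).restrict S with hν
  have hνΩ : ν (Ω : Set (EuclideanSpace ℝ (Fin n)))ᶜ = 0 := by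
    refine Measure.restrict_le_self.absolutelyContinuous ?_
    rw [Measure.restrict_apply Ω.isOpen.measurableSet.compl, Set.compl_inter_self, measure_empty]
  have hνS : ν Sᶜ = 0 := by
    rw [hν, Measure.restrict_apply hSm.compl, Set.compl_inter_self, measure_empty]
  -- Lebesgue measure has no atoms, so a finite support would make `ν` zero and hence `g = 0` a.e.
  -- in `Ω`.
  have hinf : ((Ω : Set (EuclideanSpace ℝ (Fin n))) ∩ ν.support).Infinite := by
    intro hfin
    apply hg0
    have h1 : ν Set.univ = 0 := by
      have h2 : ν ((Ω : Set (EuclideanSpace ℝ (Fin n))) ∩ ν.support) = 0 :=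
        hfin.measure_zero ν
      have h3 : ν ((Ω : Set (EuclideanSpace ℝ (Fin n))) ∩ ν.support)ᶜ = 0 := by
        rw [Set.compl_inter]
        exact measure_union_null hνΩ Measure.measure_compl_support
      rw [← Set.union_compl_self ((Ω : Set (EuclideanSpace ℝ (Fin n))) ∩ ν.support)]
      exact measure_union_null h2 h3
    rw [hν, Measure.restrict_apply_univ] at h1
    exact h1
  set p : Fin k → EuclideanSpace ℝ (Fin n) := fun i => (hinf.natEmbedding _ i.1).1 with hp
  have hpinj : Function.Injective p := fun i j hij => Fin.ext
    ((hinf.natEmbedding _).injective (Subtype.ext hij))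
  have hpm : ∀ i, p i ∈ (Ω : Set (EuclideanSpace ℝ (Fin n))) ∩ ν.support := fun i =>
    (hinf.natEmbedding _ i.1).2
  obtain ⟨U, hU, hdisj⟩ := (Set.finite_range p).t2_separation
  have hφ : ∀ i, ∃ φ : 𝓓(Ω, ℝ), tsupport φ ⊆ U (p i) ∧ φ (p i) = 1 := by
    intro i
    have hnhds : U (p i) ∩ Ω ∈ nhds (p i) :=
      Filter.inter_mem ((hU _).2.mem_nhds (hU _).1) (Ω.isOpen.mem_nhds (hpm i).1)
    obtain ⟨f, hf1, hf2, hf3, -, hf4⟩ := exists_contDiff_tsupport_subset (n := (⊤ : ℕ∞)) hnhds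
    exact ⟨⟨f, hf3, hf2, hf1.trans Set.inter_subset_right⟩, hf1.trans Set.inter_subset_left, hf4⟩
  choose φ hφU hφ1 using hφ
  choose e he _ using fun i => exists_H10_of_test (φ i)
  refine ⟨e, Fintype.linearIndependent_iff.2 fun a ha i => ?_⟩
  have h1 : weightLM hn hg (∑ j, a j • e j) = 0 := by
    simpa only [map_sum, map_smul] using ha
  have h2 : ∀ᵐ x ∂(vol Ω), g x * ∑ j, a j * φ j x = 0 := by
    have h3 := weightLM_ae hn hg (∑ j, a j • e j)
    rw [h1] at h3
    filter_upwards [h3, Lp.coeFn_zero ℝ 2 (vol Ω), fn_sum_smul_ae a e φ he] with x hx hx' hx''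
    rw [← hx'', ← hx, hx', Pi.zero_apply]
  have h4 : ∀ᵐ x ∂ν, g x * ∑ j, a j * φ j x = 0 ∧ x ∈ S :=
    (ae_restrict_of_ae h2).and (ae_restrict_mem hSm)
  have h5 : 0 < ν {x | φ i x ≠ 0} := by
    refine (Measure.mem_support_iff_forall _).1 (hpm i).2 _ ?_
    exact (isOpen_ne_fun (φ i).continuous continuous_const).mem_nhds (by simp [hφ1])
  obtain ⟨x, hx1, hx2, hx3⟩ : ∃ x, φ i x ≠ 0 ∧ g x * ∑ j, a j * φ j x = 0 ∧ x ∈ S := by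
    by_contra! hcon
    refine h5.ne' (measure_mono_null (fun x hx => ?_) h4)
    exact fun h => hcon x hx h.1 h.2
  have h6 : ∑ j, a j * φ j x = a i * φ i x := by
    refine Finset.sum_eq_single i (fun j _ hj => ?_) (by simp)
    have hxi : x ∈ U (p i) := hφU i (subset_tsupport _ hx1)
    have hxj : x ∉ U (p j) := Set.disjoint_left.1
      (hdisj ⟨i, rfl⟩ ⟨j, rfl⟩ (hpinj.ne hj.symm)) hxi
    rw [image_eq_zero_of_notMem_tsupport fun h => hxj (hφU j h), mul_zero]
  rw [h6] at hx2
  exact (mul_eq_zero.1 ((mul_eq_zero.1 hx2).resolve_left hx3)).resolve_right hx1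

theorem not_fg_range_weightLM (hn : 3 ≤ n) {g : EuclideanSpace ℝ (Fin n) → ℝ}
    (hgm : StronglyMeasurable g) (hg : MemLp g (ENNReal.ofReal n) (vol Ω))
    (hg0 : ¬ g =ᵐ[vol Ω] 0) : ¬ (LinearMap.range (weightLM hn hg)).FG := by
  intro hfg
  have hfin : Module.Finite ℝ (LinearMap.range (weightLM hn hg)) := Module.Finite.iff_fg.2 hfg
  obtain ⟨e, he⟩ := exists_linearIndependent_weightLM hn hgm hg hg0
    (Module.finrank ℝ (LinearMap.range (weightLM hn hg)) + 1)
  have he' : LinearIndependent ℝ fun i =>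
      (⟨weightLM hn hg (e i), LinearMap.mem_range_self _ _⟩ : LinearMap.range (weightLM hn hg)) :=
    LinearIndependent.of_comp (Submodule.subtype _) he
  have := he'.fintype_card_le_finrank
  simp at this

end Weight

/-! ### The energy and weight forms, and finiteness of the Morse index. -/

section Forms

variable {n : ℕ} {Ω : Opens (EuclideanSpace ℝ (Fin n))}

/-- The bilinear form `∫ ∇v·∇v' - lam ∫ v v'`. -/
def energyForm (Ω : Opens (EuclideanSpace ℝ (Fin n))) (lam : ℝ) :
    LinearMap.BilinForm ℝ (H10 Ω) :=
  LinearMap.mk₂ ℝ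
    (fun v v' => inner ℝ (gradL Ω v) (gradL Ω v') - lam * inner ℝ (fnL Ω v) (fnL Ω v'))
    (fun v v' v'' => by simp only [map_add, inner_add_left]; ring)
    (fun c v v' => by simp only [map_smul, real_inner_smul_left, smul_eq_mul]; ring)
    (fun v v' v'' => by simp only [map_add, inner_add_right]; ring)
    (fun c v v' => by simp only [map_smul, real_inner_smul_right, smul_eq_mul]; ring)

/-- The bilinear form `∫ g² v v'`. -/
def weightForm (hn : 3 ≤ n) {g : EuclideanSpace ℝ (Fin n) → ℝ}
    (hg : MemLp g (ENNReal.ofReal n) (vol Ω)) : LinearMap.BilinForm ℝ (H10 Ω) :=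
  LinearMap.mk₂ ℝ (fun v v' => inner ℝ (weightLM hn hg v) (weightLM hn hg v'))
    (fun v v' v'' => by simp only [map_add, inner_add_left])
    (fun c v v' => by simp only [map_smul, real_inner_smul_left, smul_eq_mul])
    (fun v v' v'' => by simp only [map_add, inner_add_right])
    (fun c v v' => by simp only [map_smul, real_inner_smul_right, smul_eq_mul])

theorem energyForm_apply (lam : ℝ) (v v' : H10 Ω) : energyForm Ω lam v v' =
    inner ℝ (gradL Ω v) (gradL Ω v') - lam * inner ℝ (fnL Ω v) (fnL Ω v') := rfl

theorem weightForm_apply (hn : 3 ≤ n) {g : EuclideanSpace ℝ (Fin n) → ℝ}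
    (hg : MemLp g (ENNReal.ofReal n) (vol Ω)) (v v' : H10 Ω) :
    weightForm hn hg v v' = inner ℝ (weightLM hn hg v) (weightLM hn hg v') := rfl

theorem energyForm_comm (lam : ℝ) (v v' : H10 Ω) :
    energyForm Ω lam v v' = energyForm Ω lam v' v := by
  rw [energyForm_apply, energyForm_apply, real_inner_comm (gradL Ω v),
    real_inner_comm (fnL Ω v)]

theorem weightForm_comm (hn : 3 ≤ n) {g : EuclideanSpace ℝ (Fin n) → ℝ}
    (hg : MemLp g (ENNReal.ofReal n) (vol Ω)) (v v' : H10 Ω) :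
    weightForm hn hg v v' = weightForm hn hg v' v := by
  rw [weightForm_apply, weightForm_apply, real_inner_comm]

theorem continuous_energyForm (lam : ℝ) : Continuous fun v => energyForm Ω lam v v := by
  simp only [energyForm_apply]
  fun_prop

theorem continuous_weightForm (hn : 3 ≤ n) {g : EuclideanSpace ℝ (Fin n) → ℝ}
    (hg : MemLp g (ENNReal.ofReal n) (vol Ω)) : Continuous fun v => weightForm hn hg v v :=
  (continuous_weightLM hn hg).inner (continuous_weightLM hn hg)

theorem energyForm_self (lam : ℝ) (v : H10 Ω) :
    energyForm Ω lam v v = ‖gradL Ω v‖ ^ 2 - lam * ‖fnL Ω v‖ ^ 2 := by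
  rw [energyForm_apply, real_inner_self_eq_norm_sq, real_inner_self_eq_norm_sq]

theorem weightForm_self (hn : 3 ≤ n) {g : EuclideanSpace ℝ (Fin n) → ℝ}
    (hg : MemLp g (ENNReal.ofReal n) (vol Ω)) (v : H10 Ω) :
    weightForm hn hg v v = ‖weightLM hn hg v‖ ^ 2 := by
  rw [weightForm_apply, real_inner_self_eq_norm_sq]

theorem energyForm_eq_integral (lam : ℝ) (v v' : H10 Ω) : energyForm Ω lam v v' =
    (∫ x, inner ℝ (grad v x) (grad v' x) ∂(vol Ω)) - lam * ∫ x, fn v x * fn v' x ∂(vol Ω) := by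
  rw [energyForm_apply, L2.inner_def, L2.inner_def]
  simp only [fnL_apply, gradL_apply]
  congr 2
  refine integral_congr_ae (.of_forall fun x => ?_)
  simp [mul_comm]

theorem energyForm_self_eq_integral (lam : ℝ) (v : H10 Ω) : energyForm Ω lam v v =
    ∫ x, (‖grad v x‖ ^ 2 - lam * fn v x ^ 2) ∂(vol Ω) := by
  have h1 : Integrable (fun x => ‖grad v x‖ ^ 2) (vol Ω) :=
    (memLp_two_iff_integrable_sq_norm (Lp.aestronglyMeasurable _)).1 (Lp.memLp _)
  have h2 : Integrable (fun x => fn v x ^ 2) (vol Ω) :=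
    (memLp_two_iff_integrable_sq (Lp.aestronglyMeasurable _)).1 (Lp.memLp _)
  rw [integral_sub h1 (h2.const_mul lam), integral_const_mul, integral_norm_sq_eq_norm_sq,
    integral_sq_eq_norm_sq, energyForm_self]
  rfl

theorem weightForm_eq_integral (hn : 3 ≤ n) {g : EuclideanSpace ℝ (Fin n) → ℝ}
    (hg : MemLp g (ENNReal.ofReal n) (vol Ω)) (v v' : H10 Ω) :
    weightForm hn hg v v' = ∫ x, g x ^ 2 * (fn v x * fn v' x) ∂(vol Ω) := by
  rw [weightForm_apply, L2.inner_def]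
  apply integral_congr_ae
  filter_upwards [weightLM_ae hn hg v, weightLM_ae hn hg v'] with x h1 h2
  rw [h1, h2]
  simp only [RCLike.inner_apply, conj_trivial]
  ring

/-- The form `∫ |∇v|² - lam ∫ v² - μ ∫ g² v²` has finite Morse index. -/
theorem exists_morse_bound (hn : 3 ≤ n)
    (hΩ : Bornology.IsBounded (Ω : Set (EuclideanSpace ℝ (Fin n)))) {lam μ : ℝ} (hlam : 0 ≤ lam)
    (hμ : 0 < μ) {g : EuclideanSpace ℝ (Fin n) → ℝ} (hgm : StronglyMeasurable g)
    (hg : MemLp g (ENNReal.ofReal n) (vol Ω)) :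
    ∃ M : ℕ, ∀ v : Fin (M + 1) → H10 Ω, ∃ a : Fin (M + 1) → ℝ, a ≠ 0 ∧
      0 ≤ energyForm Ω lam (∑ i, a i • v i) (∑ i, a i • v i) -
        μ * weightForm hn hg (∑ i, a i • v i) (∑ i, a i • v i) := by
  -- With this `ε`, the weight term costs half of `‖∇v‖₂²`. The choice of `δ` lets the other half
  -- absorb `(lam + μ A) ‖v‖₂²`; the `+ 1` keeps the inverted quantity visibly positive.
  obtain ⟨A, hA0, hA⟩ := exists_norm_weightLM_sq_le hn hgm hg (ε := (2 * μ)⁻¹) (by positivity)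
  obtain ⟨J, l, hl⟩ := exists_functionals_norm_le hΩ (δ := (2 * (lam + μ * A + 1))⁻¹)
    (by positivity)
  refine ⟨J.card, fun v => ?_⟩
  -- There are `J.card` conditions on `J.card + 1` coefficients, so some nontrivial combination
  -- satisfies them all.
  set Φ : (Fin (J.card + 1) → ℝ) →ₗ[ℝ] (J → ℝ) := LinearMap.pi fun z =>
    (l z : Lp ℝ 2 (vol Ω) →ₗ[ℝ] ℝ) ∘ₗ (fnL Ω : H10 Ω →ₗ[ℝ] Lp ℝ 2 (vol Ω)) ∘ₗ
      Fintype.linearCombination ℝ v with hΦ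
  have hker : LinearMap.ker Φ ≠ ⊥ := LinearMap.ker_ne_bot_of_finrank_lt (by simp)
  obtain ⟨a, ha, ha0⟩ := Submodule.exists_mem_ne_zero_of_ne_bot hker
  refine ⟨a, ha0, ?_⟩
  set x := ∑ i, a i • v i with hx
  have h1 := hl x fun z hz => congrFun (LinearMap.mem_ker.1 ha) ⟨z, hz⟩
  have h2 := hA x
  rw [energyForm_self, weightForm_self]
  have h3 : μ * ‖weightLM hn hg x‖ ^ 2 ≤ μ * A * ‖fnL Ω x‖ ^ 2 + 2⁻¹ * ‖gradL Ω x‖ ^ 2 := by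
    have h := mul_le_mul_of_nonneg_left h2 hμ.le
    have e : μ * (2 * μ)⁻¹ = 2⁻¹ := by field_simp
    calc _ ≤ _ := h
      _ = μ * A * ‖fnL Ω x‖ ^ 2 + μ * (2 * μ)⁻¹ * ‖gradL Ω x‖ ^ 2 := by ring
      _ = _ := by rw [e]
  have h4 : (lam + μ * A + 1) * ‖fnL Ω x‖ ^ 2 ≤ 2⁻¹ * ‖gradL Ω x‖ ^ 2 := by
    have hΛ : 0 < lam + μ * A + 1 := by positivity
    have h := mul_le_mul_of_nonneg_left h1 hΛ.le
    have e : (lam + μ * A + 1) * (2 * (lam + μ * A + 1))⁻¹ = 2⁻¹ := by field_simp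
    rwa [← mul_assoc, e] at h
  linarith [sq_nonneg ‖fnL Ω x‖]

/-- The weighted kernel `K_w` meets `H¹₀(Ω)` in the kernel of multiplication by `w^{2/(n-2)}`. -/
theorem linearIndependent_mkQ_weightNull_iff (hn : 3 ≤ n) {w : EuclideanSpace ℝ (Fin n) → ℝ}
    (hg : MemLp (fun x => w x ^ (2 / ((n : ℝ) - 2))) (ENNReal.ofReal n) (vol Ω)) {k : ℕ}
    (v : Fin k → H10 Ω) :
    LinearIndependent ℝ
      (fun i => (weightNull Ω w).mkQ (fn (v i) : EuclideanSpace ℝ (Fin n) →ₘ[vol Ω] ℝ)) ↔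
    LinearIndependent ℝ (fun i => weightLM hn hg (v i)) := by
  let κ : H10 Ω →ₗ[ℝ] (EuclideanSpace ℝ (Fin n) →ₘ[vol Ω] ℝ) :=
    { toFun := fun v => (fn v : EuclideanSpace ℝ (Fin n) →ₘ[vol Ω] ℝ)
      map_add' := fun _ _ => rfl
      map_smul' := fun _ _ => rfl }
  have hker : ∀ x : H10 Ω, (weightNull Ω w).mkQ (κ x) = 0 ↔ weightLM hn hg x = 0 := by
    intro x
    rw [Submodule.mkQ_apply, Submodule.Quotient.mk_eq_zero, Lp.eq_zero_iff_ae_eq_zero]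
    have h := weightLM_ae hn hg x
    constructor
    · intro h'
      filter_upwards [h, h'] with y hy hy'
      rw [hy]
      exact hy'
    · intro h'
      change ∀ᵐ y ∂(vol Ω), w y ^ (2 / ((n : ℝ) - 2)) * fn x y = 0
      filter_upwards [h, h'] with y hy hy'
      rw [← hy, hy', Pi.zero_apply]
  have hcomb : ∀ a : Fin k → ℝ, ∑ i, a i • (weightNull Ω w).mkQ (κ (v i)) = 0 ↔
      ∑ i, a i • weightLM hn hg (v i) = 0 := by
    intro a
    simpa only [map_sum, map_smul] using hker (∑ i, a i • v i)
  change LinearIndependent ℝ (fun i => (weightNull Ω w).mkQ (κ (v i))) ↔ _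
  rw [Fintype.linearIndependent_iff, Fintype.linearIndependent_iff]
  simp only [hcomb]

/-- Ensures that Rayleigh quotients on trial spaces have positive denominators, so that division by
zero never enters the min-max. -/
theorem weightForm_pos_of_linearIndependent (hn : 3 ≤ n) {g : EuclideanSpace ℝ (Fin n) → ℝ}
    (hg : MemLp g (ENNReal.ofReal n) (vol Ω)) {k : ℕ} {v : Fin k → H10 Ω}
    (hv : LinearIndependent ℝ (fun i => weightLM hn hg (v i))) {a : Fin k → ℝ} (ha : a ≠ 0) :
    0 < weightForm hn hg (∑ i, a i • v i) (∑ i, a i • v i) := by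
  rw [weightForm_self]
  refine pow_pos (norm_pos_iff.2 fun h0 => ha ?_) 2
  funext i
  refine Fintype.linearIndependent_iff.1 hv a ?_ i
  simpa only [map_sum, map_smul] using h0

end Forms

/-! ### The weight `|u|^{2*-2}` and the passage to generalised eigenvalues. -/

section Weight

variable {n : ℕ} {Ω : Opens (EuclideanSpace ℝ (Fin n))}

theorem critExp_sub_two (hn : 3 ≤ n) : critExp n - 2 = 2 / ((n : ℝ) - 2) * 2 := by
  have hn' : (3 : ℝ) ≤ n := by exact_mod_cast hn
  have : (n : ℝ) - 2 ≠ 0 := by linarith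
  rw [critExp]
  field_simp
  ring

theorem rpow_weight_sq (hn : 3 ≤ n) {t : ℝ} (ht : 0 ≤ t) :
    (t ^ (2 / ((n : ℝ) - 2))) ^ 2 = t ^ (critExp n - 2) := by
  rw [critExp_sub_two hn, Real.rpow_mul ht, Real.rpow_two]

theorem stronglyMeasurable_weight (u : H10 Ω) :
    StronglyMeasurable fun x => |fn u x| ^ (2 / ((n : ℝ) - 2)) :=
  ((Lp.stronglyMeasurable (fn u)).measurable.abs.pow_const _).stronglyMeasurable

/-- The power `2/(n-2)` takes `L^{2*}` to `Lⁿ`, because `2* / (2/(n-2)) = n`. -/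
theorem memLp_weight (hn : 3 ≤ n) (u : H10 Ω) :
    MemLp (fun x => |fn u x| ^ (2 / ((n : ℝ) - 2))) (ENNReal.ofReal n) (vol Ω) := by
  have hn' : (3 : ℝ) ≤ n := by exact_mod_cast hn
  have hpos : 0 < 2 / ((n : ℝ) - 2) := div_pos two_pos (by linarith)
  have h := (memLp_critExp hn u).norm_rpow_div (ENNReal.ofReal (2 / ((n : ℝ) - 2)))
  rw [ENNReal.toReal_ofReal hpos.le, ← ENNReal.ofReal_div_of_pos hpos] at h
  have e : critExp n / (2 / ((n : ℝ) - 2)) = n := by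
    have : (n : ℝ) - 2 ≠ 0 := by linarith
    rw [critExp]
    field_simp
  rwa [e] at h

/-- Serves twice: it shows that `u` has positive weighted norm and that the weight itself is not
a.e. zero. -/
theorem weight_ne_zero {u : H10 Ω} (hu : u ≠ 0) (s : ℝ) :
    ¬ (fun x => |fn u x| ^ s * fn u x) =ᵐ[vol Ω] 0 := by
  intro h
  refine hu (eq_zero_of_fn_eq_zero ((Lp.eq_zero_iff_ae_eq_zero).2 ?_))
  filter_upwards [h] with x hx
  by_contra h0
  have h1 : |fn u x| ^ s ≠ 0 := (Real.rpow_pos_of_pos (abs_pos.2 h0) s).ne'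
  exact mul_ne_zero h1 h0 hx

theorem rayleigh_eq (hn : 3 ≤ n) (lam : ℝ) (u v : H10 Ω) :
    rayleigh lam (fun x => |fn u x|) v =
      energyForm Ω lam v v / weightForm hn (memLp_weight hn u) v v := by
  rw [rayleigh, energyForm_self_eq_integral, weightForm_eq_integral]
  simp only [rpow_weight_sq hn (abs_nonneg _), ← sq]

theorem isWeakSol_iff_weightForm (hn : 3 ≤ n) (lam μ : ℝ) (u φ : H10 Ω) :
    IsWeakSol lam φ (fun x => μ * |fn u x| ^ (critExp n - 2) * fn φ x) ↔
      ∀ v, energyForm Ω lam φ v = μ * weightForm hn (memLp_weight hn u) φ v := by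
  refine forall_congr' fun v => ?_
  rw [energyForm_eq_integral, weightForm_eq_integral, ← integral_const_mul μ]
  simp only [rpow_weight_sq hn (abs_nonneg _), mul_assoc]

/-- If `u ≠ 0` solves `-Δu - lam u = μ |u|^{2*-2} u` with `μ > 0`, then `μ` is a generalised
eigenvalue for the weight `|u|`. -/
theorem exists_genEigenvalue_eq (hn : 3 ≤ n)
    (hΩ : Bornology.IsBounded (Ω : Set (EuclideanSpace ℝ (Fin n)))) {lam μ : ℝ} (hlam : 0 ≤ lam)
    (hμ : 0 < μ) {u : H10 Ω} (hu : u ≠ 0)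
    (hsol : IsWeakSol lam u (fun x => μ * |fn u x| ^ (critExp n - 2) * fn u x)) :
    ∃ k : ℕ, 1 ≤ k ∧ genEigenvalue Ω lam (fun x => |fn u x|) k = (μ : EReal) := by
  have hgm := stronglyMeasurable_weight u
  have hg := memLp_weight hn u
  have hTu : weightLM hn hg u ≠ 0 := fun h0 => weight_ne_zero hu (2 / ((n : ℝ) - 2))
    ((weightLM_ae hn hg u).symm.trans ((Lp.eq_zero_iff_ae_eq_zero).1 h0))
  have hg0 : ¬ (fun x => |fn u x| ^ (2 / ((n : ℝ) - 2))) =ᵐ[vol Ω] 0 := fun h0 =>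
    weight_ne_zero hu (2 / ((n : ℝ) - 2)) <| by
      filter_upwards [h0] with x hx
      rw [hx]
      simp
  obtain ⟨M, hM⟩ := exists_morse_bound hn hΩ hlam hμ hgm hg
  obtain ⟨k, hk, hlow, hup⟩ := exists_minmax_index (weightLM hn hg)
    (not_fg_range_weightLM hn hgm hg hg0) (energyForm Ω lam) (weightForm hn hg)
    (energyForm_comm lam) (weightForm_comm hn hg)
    (continuous_energyForm lam) (continuous_weightForm hn hg)
    (fun v => by rw [weightForm_self]; positivity) hM (u := u)
    (by rw [weightForm_self]; exact pow_pos (norm_pos_iff.2 hTu) 2)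
    ((isWeakSol_iff_weightForm hn lam μ u u).1 hsol)
  refine ⟨k, hk, le_antisymm ?_ ?_⟩
  -- It suffices to bound the infimum by each real `s > μ`, which the trial families for `s` do;
  -- attainment at `μ` is not needed.
  · rw [← EReal.le_of_forall_lt_iff_le]
    intro s hs
    obtain ⟨v, hv, hneg⟩ := hup s (EReal.coe_lt_coe_iff.1 hs)
    refine iInf₂_le_of_le (Submodule.span ℝ (Set.range v))
      ⟨v, rfl, (linearIndependent_mkQ_weightNull_iff hn hg v).2 hv⟩ ?_
    refine iSup₂_le ?_
    rintro x ⟨hxV, hx0⟩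
    obtain ⟨a, rfl⟩ := (Submodule.mem_span_range_iff_exists_fun ℝ).1 hxV
    have ha : a ≠ 0 := by
      rintro rfl
      simp at hx0
    rw [EReal.coe_le_coe_iff, rayleigh_eq hn,
      div_le_iff₀ (weightForm_pos_of_linearIndependent hn hg hv ha)]
    exact (hneg a ha).le
  · refine le_iInf₂ ?_
    rintro V ⟨v, rfl, hv⟩
    rw [linearIndependent_mkQ_weightNull_iff hn hg] at hv
    obtain ⟨a, ha, hle⟩ := hlow v
    have hpos := weightForm_pos_of_linearIndependent hn hg hv ha
    refine le_iSup₂_of_le (∑ i, a i • v i)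
      ⟨(Submodule.mem_span_range_iff_exists_fun ℝ).2 ⟨a, rfl⟩, ?_⟩ ?_
    -- The vector is nonzero since its weight form is positive.
    · intro h0
      rw [h0] at hpos
      simp at hpos
    · rw [EReal.coe_le_coe_iff, rayleigh_eq hn, le_div_iff₀ hpos]
      exact hle

/-- Normalising the solution turns the nonlinear problem into a weighted linear one. -/
theorem solvesBN_iff_isWeakSol {lam c : ℝ} (hc : 0 < c) {u u' : H10 Ω} (hu' : u' = c⁻¹ • u) :
    SolvesBN lam u ↔ IsWeakSol lam u'
      (fun x => c ^ (critExp n - 2) * |fn u' x| ^ (critExp n - 2) * fn u' x) := by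
  refine forall_congr' fun v => ?_
  have h1 : ∫ x, c ^ (critExp n - 2) * |fn u' x| ^ (critExp n - 2) * fn u' x * fn v x ∂(vol Ω) =
      c⁻¹ * ∫ x, |fn u x| ^ (critExp n - 2) * fn u x * fn v x ∂(vol Ω) := by
    rw [← integral_const_mul]
    apply integral_congr_ae
    filter_upwards [Lp.coeFn_smul c⁻¹ (fn u)] with x hx
    have hx' : fn u' x = c⁻¹ * fn u x := by
      rw [hu']
      exact hx
    have hpow : c ^ (critExp n - 2) * |c⁻¹ * fn u x| ^ (critExp n - 2) =
        |fn u x| ^ (critExp n - 2) := by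
      rw [← Real.mul_rpow hc.le (abs_nonneg _), abs_mul, abs_of_pos (inv_pos.2 hc),
        mul_inv_cancel_left₀ hc.ne']
    rw [hx', hpow]
    ring
  rw [← energyForm_eq_integral, ← energyForm_eq_integral, h1, hu', map_smul,
    LinearMap.smul_apply, smul_eq_mul]
  -- The factor `c^{2*-2}` offsets the scaling of the weight, so both sides carry just one factor
  -- `c⁻¹`.
  exact (mul_right_inj' (inv_pos.2 hc).ne').symm

end Weight

end BrezisNirenberg

end

theorem mainTheorem8 (n : ℕ) (hn : 3 ≤ n)
    (Ω : TopologicalSpace.Opens (EuclideanSpace ℝ (Fin n)))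
    (hΩ : BrezisNirenberg.IsSmoothBoundedDomain Ω) (lam : ℝ) (hlam : 0 ≤ lam)
    (u u' : BrezisNirenberg.H10 Ω) (hu : u ≠ 0)
    (hu' : u' = (BrezisNirenberg.critNorm u)⁻¹ • u) :
    BrezisNirenberg.SolvesBN lam u ↔
      ∃ k : ℕ, 1 ≤ k ∧
        BrezisNirenberg.genEigenvalue Ω lam (fun x => |BrezisNirenberg.fn u' x|) k =
          ((BrezisNirenberg.critNorm u ^ (BrezisNirenberg.critExp n - 2) : ℝ) : EReal) ∧
        u' ∈ BrezisNirenberg.genEigenspace Ω lam (fun x => |BrezisNirenberg.fn u' x|) k := by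
  have hc := BrezisNirenberg.critNorm_pos hn hu
  rw [BrezisNirenberg.solvesBN_iff_isWeakSol hc hu']
  constructor
  · intro h
    have hu'0 : u' ≠ 0 := by
      rw [hu']
      exact smul_ne_zero (inv_pos.2 hc).ne' hu
    obtain ⟨k, hk, hμ⟩ := BrezisNirenberg.exists_genEigenvalue_eq hn hΩ.isBounded hlam
      (Real.rpow_pos_of_pos hc _) hu'0 h
    exact ⟨k, hk, hμ, _, hμ, h⟩
  · rintro ⟨k, -, hμ, μ, hμ', h⟩
    -- The real number supplied by the eigenspace is identified with `‖u‖_{2*}^{2*-2}`, both being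
    -- the value of the same eigenvalue.
    rw [hμ', EReal.coe_eq_coe_iff] at hμ
    rwa [hμ] at h
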